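/- Let $d,n\ge 0$ and let $\Lambda=(\lambda_1\ \cdots\ \lambda_n)$ be a real $d\times n$ matrix with columns $\lambda_1,\dots,\lambda_n\in\mathbb R^d$. Let $\mathbb R^d$ act on $\mathbb R^n$ affinely by $$x\triangleright y \;=\; y+\Lambda^T x ,\qquad x\in\mathbb R^d,\ y\in\mathbb R^n,$$ and let $\alpha$ be the induced action on $C_0(\mathbb R^n)$, $(\alpha_{-x}f)(y)=f(x\triangleright y)$, restricted to $\mathbb Z^d\subset\mathbb R^d$. Let $\mathbb T^d=\mathbb R^d/\mathbb Z^d$, and let $\hat\alpha$ be the action of $\mathbb R^n$ on $C(\mathbb T^d)$ induced by the action $(y,k)\mapsto k-\Lambda y$ of $\mathbb R^n$ on $\mathbb T^d$, that is, $(\hat\alpha_{-y}f)(k)=f(k-\Lambda y)$. Then there is an isomorphism of $C^*$-algebras $$C_0(\mathbb R^n)\rtimes_{\alpha}\mathbb Z^d\;\cong\; C(\mathbb T^d)\rtimes_{\hat\alpha}\mathbb R^n .$$ Here, for a strongly continuous action $\beta$ of a locally compact abelian group $G$ with Haar measure $\mu$ on a $C^*$-algebra $A$, the crossed product $A\rtimes_\beta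 G$ is the universal one, i.e. the $C^*$-algebra generated by the elements $\big(\pi(a)\int_G g(s)U_s\,d\mu(s)\big)_{(\pi,U)}$ with $a\in A$ and $g\in C_c(G)$, where $(\pi,U)$ runs over all nondegenerate covariant representations of $(A,G,\beta)$ on Hilbert spaces; equivalently, the completion of the convolution algebra $C_c(G,A)$ in the universal norm. -/

import Mathlib

open MeasureTheory Filter Topology
open scoped ENNReal ZeroAtInfty CompactlySupported

noncomputable section

/-! ### C*-dynamical systems and covariant representations -/

/-- A C*-dynamical system `(A, G, α)` over an abelian topological group `G` (written additively):
a strongly continuous action `α` of `G` on `A` by *-automorphisms. -/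
structure CStarSystem (G : Type*) (A : Type*) [AddCommGroup G] [TopologicalSpace G]
    [NonUnitalCStarAlgebra A] where
  /-- the automorphism `α_s` -/
  act : G → (A ≃⋆ₐ[ℂ] A)
  act_zero : ∀ a, act 0 a = a
  act_add : ∀ s t a, act (s + t) a = act s (act t a)
  continuous_act : ∀ a, Continuous fun s => act s a

/-- Restriction of a C*-dynamical system along a continuous homomorphism. -/
def CStarSystem.restrict {K G A : Type*} [AddCommGroup K] [TopologicalSpace K]
    [AddCommGroup G] [TopologicalSpace G] [NonUnitalCStarAlgebra A]
    (S : CStarSystem G A) (φ : K →ₜ+ G) : CStarSystem K A where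
  act k := S.act (φ k)
  act_zero a := by simp [S.act_zero]
  act_add s t a := by simp [S.act_add]
  continuous_act a := (S.continuous_act a).comp φ.continuous_toFun

universe u v

/-- A (nondegenerate) covariant representation `(π, U)` of a C*-dynamical system on a complex
Hilbert space `H`. The universe of `H` is large enough for every cyclic covariant representation
to be unitarily equivalent to one listed here, so suprema over all covariant representations
are computed inside this type. -/
structure CovariantRep {G : Type u} {A : Type v} [AddCommGroup G] [TopologicalSpace G]
    [NonUnitalCStarAlgebra A] (S : CStarSystem G A) where
  /-- the Hilbert space -/
  H : Type (max u v)
  [normedAddCommGroup : NormedAddCommGroup H]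
  [innerProductSpace : InnerProductSpace ℂ H]
  [completeSpace : CompleteSpace H]
  /-- the representation of the algebra -/
  π : A →⋆ₙₐ[ℂ] (H →L[ℂ] H)
  nondegenerate :
    (Submodule.span ℂ {η : H | ∃ a ξ, η = π a ξ}).topologicalClosure = ⊤
  /-- the strongly continuous unitary representation of the group -/
  U : G → (H ≃ₗᵢ[ℂ] H)
  U_zero : ∀ ξ, U 0 ξ = ξ
  U_add : ∀ s t ξ, U (s + t) ξ = U s (U t ξ)
  continuous_U : ∀ ξ, Continuous fun s => U s ξ
  /-- `U_s π(a) U_s* = π(α_s(a))` -/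
  covariant : ∀ s a ξ, U s (π a ξ) = π (S.act s a) (U s ξ)

attribute [instance] CovariantRep.normedAddCommGroup CovariantRep.innerProductSpace
  CovariantRep.completeSpace

section CrossedProduct

variable {G : Type u} {A : Type v} [AddCommGroup G] [TopologicalSpace G]
  [NonUnitalCStarAlgebra A] {S : CStarSystem G A}
  [MeasurableSpace G] [BorelSpace G]

theorem CovariantRep.integrable_smul_U (ρ : CovariantRep S) (μ : Measure G)
    [IsFiniteMeasureOnCompacts μ] (g : C_c(G, ℂ)) (ξ : ρ.H) :
    Integrable (fun s => g s • ρ.U s ξ) μ :=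
  (g.continuous.smul (ρ.continuous_U ξ)).integrable_of_hasCompactSupport
    (g.hasCompactSupport.smul_right)

set_option linter.unusedSectionVars false in
theorem CovariantRep.norm_integral_le (ρ : CovariantRep S) (μ : Measure G)
    (g : C_c(G, ℂ)) (ξ : ρ.H) :
    ‖∫ s, g s • ρ.U s ξ ∂μ‖ ≤ (∫ s, ‖g s‖ ∂μ) * ‖ξ‖ := by
  refine (norm_integral_le_integral_norm _).trans (le_of_eq ?_)
  simp_rw [norm_smul, LinearIsometryEquiv.norm_map]
  exact integral_mul_const _ _

/-- The bounded operator `U(g) = ∫ g(s) U_s dμ(s)` for `g ∈ C_c(G)`, as a strong integral. -/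
def CovariantRep.integrated (ρ : CovariantRep S) (μ : Measure G)
    [IsFiniteMeasureOnCompacts μ] (g : C_c(G, ℂ)) : ρ.H →L[ℂ] ρ.H :=
  LinearMap.mkContinuous
    { toFun := fun ξ => ∫ s, g s • ρ.U s ξ ∂μ
      map_add' := fun ξ η => by
        simp_rw [map_add, smul_add]
        exact integral_add (ρ.integrable_smul_U μ g ξ) (ρ.integrable_smul_U μ g η)
      map_smul' := fun c ξ => by
        simp_rw [map_smul, smul_comm _ c]
        exact integral_smul c _ }
    (∫ s, ‖g s‖ ∂μ) (fun ξ => ρ.norm_integral_le μ g ξ)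

theorem CovariantRep.norm_integrated_le (ρ : CovariantRep S) (μ : Measure G)
    [IsFiniteMeasureOnCompacts μ] (g : C_c(G, ℂ)) :
    ‖ρ.integrated μ g‖ ≤ ∫ s, ‖g s‖ ∂μ :=
  LinearMap.mkContinuous_norm_le _ (integral_nonneg fun _ => norm_nonneg _) _

variable (S) in
/-- The C*-algebra `∏_ρ B(H_ρ)` of bounded families of operators, `ρ` running over all covariant
representations. -/
abbrev UniversalAlgebra : Type _ :=
  lp (fun ρ : CovariantRep S => ρ.H →L[ℂ] ρ.H) ∞

variable (S) in
/-- The image of the elementary function `a ⊗ g ∈ C_c(G, A)`, `s ↦ g(s) a`, under the integrated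
form of the universal covariant representation: the family `(π_ρ(a) ∫ g(s) U_ρ(s) dμ(s))_ρ`. -/
def crossedElement (μ : Measure G) [IsFiniteMeasureOnCompacts μ] (a : A) (g : C_c(G, ℂ)) :
    UniversalAlgebra S :=
  ⟨fun ρ => ρ.π a * ρ.integrated μ g, by
    refine memℓp_infty ⟨‖a‖ * ∫ s, ‖g s‖ ∂μ, ?_⟩
    rintro _ ⟨ρ, rfl⟩
    refine (norm_mul_le _ _).trans ?_
    exact mul_le_mul (NonUnitalStarAlgHom.norm_apply_le ρ.π a) (ρ.norm_integrated_le μ g)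
      (norm_nonneg _) (norm_nonneg _)⟩

variable (S) in
/-- The (full) crossed product, as a closed *-subalgebra of `∏_ρ B(H_ρ)`. The norm inherited from
the product is the universal norm `sup_ρ ‖(π_ρ ⋊ U_ρ)(f)‖`, and the elementary functions `a ⊗ g`
span a subspace of the convolution algebra `C_c(G, A)` that is dense in the inductive limit
topology; hence this closed *-algebra is the completion of `C_c(G, A)` in the universal norm. It
does not depend on the normalization of the Haar measure `μ`. -/
def crossedProductSubalgebra (μ : Measure G) [μ.IsAddHaarMeasure] :
    NonUnitalStarSubalgebra ℂ (UniversalAlgebra S) :=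
  (NonUnitalStarAlgebra.adjoin ℂ
    (Set.range fun p : A × C_c(G, ℂ) => crossedElement S μ p.1 p.2)).topologicalClosure

variable (S) in
/-- The (full) crossed product C*-algebra `A ⋊_α G` of a C*-dynamical system over a locally compact
abelian group `G` with Haar measure `μ`. -/
def CrossedProduct (μ : Measure G) [μ.IsAddHaarMeasure] : Type _ :=
  crossedProductSubalgebra S μ

instance (μ : Measure G) [μ.IsAddHaarMeasure] : NonUnitalCStarAlgebra (CrossedProduct S μ) :=
  NonUnitalStarSubalgebra.nonUnitalCStarAlgebra (crossedProductSubalgebra S μ)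
    (h_closed := NonUnitalStarSubalgebra.isClosed_topologicalClosure _)

end CrossedProduct

/-! ### Systems induced by actions on spaces -/

/-- A (jointly) continuous action `(s, x) ↦ s ▹ x` of an abelian topological group on a space. -/
structure TopAction (G X : Type*) [AddCommGroup G] [TopologicalSpace G] [TopologicalSpace X] where
  /-- the map `x ↦ s ▹ x` -/
  act : G → X → X
  act_zero : ∀ x, act 0 x = x
  act_add : ∀ s t x, act (s + t) x = act s (act t x)
  continuous_act : Continuous fun p : G × X => act p.1 p.2

namespace TopAction

variable {G X : Type*} [AddCommGroup G] [TopologicalSpace G] [TopologicalSpace X]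

/-- The homeomorphism `x ↦ s ▹ x`. -/
def homeo (T : TopAction G X) (s : G) : X ≃ₜ X where
  toFun := T.act s
  invFun := T.act (-s)
  left_inv x := by rw [← T.act_add, neg_add_cancel, T.act_zero]
  right_inv x := by rw [← T.act_add, add_neg_cancel, T.act_zero]
  continuous_toFun := T.continuous_act.comp (Continuous.prodMk_right s)
  continuous_invFun := T.continuous_act.comp (Continuous.prodMk_right (-s))

/-- Pull-back of `C₀` functions along `x ↦ s ▹ x`. -/
def pullbackC0 (T : TopAction G X) (s : G) (f : C₀(X, ℂ)) : C₀(X, ℂ) :=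
  f.comp (T.homeo s).toCocompactMap

@[simp] theorem pullbackC0_apply (T : TopAction G X) (s : G) (f : C₀(X, ℂ)) (x : X) :
    T.pullbackC0 s f x = f (T.act s x) := rfl

/-- The induced automorphism `α_s` of `C₀(X)`, `(α_s f)(x) = f((-s) ▹ x)`,
equivalently `(α_{-s} f)(x) = f(s ▹ x)`. -/
def autC0 (T : TopAction G X) (s : G) : C₀(X, ℂ) ≃⋆ₐ[ℂ] C₀(X, ℂ) where
  toFun := T.pullbackC0 (-s)
  invFun := T.pullbackC0 s
  left_inv f := by ext x; simp [← T.act_add, T.act_zero]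
  right_inv f := by ext x; simp [← T.act_add, T.act_zero]
  map_mul' f g := by ext x; simp
  map_add' f g := by ext x; simp
  map_star' f := by ext x; simp
  map_smul' c f := by ext x; simp

theorem autC0_apply (T : TopAction G X) (s : G) (f : C₀(X, ℂ)) (x : X) :
    T.autC0 s f x = f (T.act (-s) x) := rfl

/-- The induced automorphism `α_s` of `C(X)`, `(α_s f)(x) = f((-s) ▹ x)`. -/
def autC (T : TopAction G X) (s : G) : C(X, ℂ) ≃⋆ₐ[ℂ] C(X, ℂ) where
  toFun f := f.comp (T.homeo (-s) : C(X, X))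
  invFun f := f.comp (T.homeo s : C(X, X))
  left_inv f := by ext x; simp [homeo, ← T.act_add, T.act_zero]
  right_inv f := by ext x; simp [homeo, ← T.act_add, T.act_zero]
  map_mul' f g := by ext x; simp
  map_add' f g := by ext x; simp
  map_star' f := by ext x; simp
  map_smul' c f := by ext x; simp

theorem autC_apply (T : TopAction G X) (s : G) (f : C(X, ℂ)) (x : X) :
    T.autC s f x = f (T.act (-s) x) := rfl

variable [IsTopologicalAddGroup G]

theorem continuous_autC0 [LocallyCompactSpace G] (T : TopAction G X)
    (f : C₀(X, ℂ)) : Continuous fun s => T.autC0 s f := by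
  rw [continuous_iff_continuousAt]
  intro s₀
  rw [ContinuousAt, ZeroAtInftyContinuousMap.tendsto_iff_tendstoUniformly,
    Metric.tendstoUniformly_iff]
  intro ε hε
  obtain ⟨V, hV, hVs⟩ := exists_compact_mem_nhds s₀
  have hK : ∀ᶠ x in cocompact X, ‖f x‖ < ε / 2 := by
    have h := (zero_at_infty f).norm
    rw [norm_zero] at h
    exact h.eventually (gt_mem_nhds (half_pos hε))
  obtain ⟨K, hKc, hK⟩ := mem_cocompact.1 hK
  have hL : IsCompact ((fun p : G × X => T.act p.1 p.2) '' (V ×ˢ K)) :=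
    (hV.prod hKc).image T.continuous_act
  set L := (fun p : G × X => T.act p.1 p.2) '' (V ×ˢ K) with hLdef
  have hcont : Continuous fun p : G × X => f (T.act (-p.1) p.2) :=
    f.continuous.comp (T.continuous_act.comp (continuous_fst.neg.prodMk continuous_snd))
  have hunif : ∀ᶠ s in 𝓝 s₀, ∀ x ∈ L, dist (f (T.act (-s₀) x)) (f (T.act (-s) x)) < ε := by
    refine hL.eventually_forall_of_forall_eventually fun x _ => ?_
    have h1 : Continuous fun p : G × X =>
        dist (f (T.act (-s₀) p.2)) (f (T.act (-p.1) p.2)) :=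
      (hcont.comp (continuous_const.prodMk continuous_snd)).dist hcont
    have h2 := h1.tendsto (s₀, x)
    simp only [dist_self] at h2
    exact h2.eventually (gt_mem_nhds hε)
  have hout : ∀ s ∈ V, ∀ x, x ∉ L → ‖f (T.act (-s) x)‖ < ε / 2 := by
    intro s hs x hx
    refine hK fun hmem => hx ⟨(s, T.act (-s) x), ⟨hs, hmem⟩, ?_⟩
    simp [← T.act_add, T.act_zero]
  filter_upwards [hunif, hVs] with s hs hsV x
  by_cases hx : x ∈ L
  · exact hs x hx
  · have h1 := hout s hsV x hx
    have h2 := hout s₀ (mem_of_mem_nhds hVs) x hx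
    rw [autC0_apply, autC0_apply, dist_eq_norm]
    exact (norm_sub_le _ _).trans_lt (by linarith)

theorem continuous_autC (T : TopAction G X)
    (f : C(X, ℂ)) : Continuous fun s => T.autC s f := by
  have hcont : Continuous fun p : G × X => f (T.act (-p.1) p.2) :=
    f.continuous.comp (T.continuous_act.comp (continuous_fst.neg.prodMk continuous_snd))
  exact (ContinuousMap.curry ⟨_, hcont⟩).continuous

/-- The C*-dynamical system `(C₀(X), G, α)` of a continuous action, `(α_{-s} f)(x) = f(s ▹ x)`. -/
def systemC0 [LocallyCompactSpace G] (T : TopAction G X) : CStarSystem G C₀(X, ℂ) where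
  act := T.autC0
  act_zero f := by ext x; simp [autC0_apply, T.act_zero]
  act_add s t f := by
    ext x
    rw [autC0_apply, autC0_apply, autC0_apply, ← T.act_add, neg_add_rev]
  continuous_act := T.continuous_autC0

/-- The C*-dynamical system `(C(X), G, α)` of a continuous action on a compact space,
`(α_{-s} f)(x) = f(s ▹ x)`. -/
def systemC [CompactSpace X] (T : TopAction G X) : CStarSystem G C(X, ℂ) where
  act := T.autC
  act_zero f := by ext x; simp [autC_apply, T.act_zero]
  act_add s t f := by
    ext x
    rw [autC_apply, autC_apply, autC_apply, ← T.act_add, neg_add_rev]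
  continuous_act := T.continuous_autC

end TopAction

/-! ### The affine action and its dual -/

open scoped Matrix

variable {d n : ℕ}

/-- The affine action `x ▹ y = y + Λᵀ x` of `ℝᵈ` on `ℝⁿ`. -/
def affineAction (Λ : Matrix (Fin d) (Fin n) ℝ) :
    TopAction (EuclideanSpace ℝ (Fin d)) (EuclideanSpace ℝ (Fin n)) where
  act x y := y + Matrix.toEuclideanLin Λᵀ x
  act_zero y := by simp
  act_add s t y := by rw [map_add]; abel
  continuous_act := continuous_snd.add
    ((LinearMap.continuous_of_finiteDimensional _).comp continuous_fst)

/-- The quotient homomorphism `ℝᵈ → 𝕋ᵈ = ℝᵈ / ℤᵈ`. -/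
def toTorus (x : EuclideanSpace ℝ (Fin d)) : UnitAddTorus (Fin d) :=
  fun i => (x i : UnitAddCircle)

/-- The action `(y, k) ↦ k - Λ y` of `ℝⁿ` on `𝕋ᵈ`. -/
def torusAction (Λ : Matrix (Fin d) (Fin n) ℝ) :
    TopAction (EuclideanSpace ℝ (Fin n)) (UnitAddTorus (Fin d)) where
  act y k := k - toTorus (Matrix.toEuclideanLin Λ y)
  act_zero k := by ext i; simp [toTorus]
  act_add s t k := by
    ext i
    simp only [toTorus, map_add, PiLp.add_apply, AddCircle.coe_add, Pi.sub_apply]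
    abel
  continuous_act := by
    refine continuous_snd.sub (continuous_pi fun i => ?_)
    refine (AddCircle.continuous_mk' 1).comp ?_
    exact (PiLp.continuous_apply 2 (fun _ : Fin d => ℝ) i).comp
      ((LinearMap.continuous_of_finiteDimensional _).comp continuous_fst)

/-- The inclusion `ℤᵈ → ℝᵈ`. -/
def latticeInclusion (d : ℕ) : (Fin d → ℤ) →ₜ+ EuclideanSpace ℝ (Fin d) where
  toFun q := WithLp.toLp 2 fun i => (q i : ℝ)
  map_zero' := by ext i; simp
  map_add' p q := by ext i; simp
  continuous_toFun := continuous_of_discreteTopology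

/-- The system `(C₀(ℝⁿ), ℤᵈ, α)`, where `α` is the restriction to `ℤᵈ` of the `ℝᵈ`-action induced by
`x ▹ y = y + Λᵀ x`. -/
def affineSystem (Λ : Matrix (Fin d) (Fin n) ℝ) :
    CStarSystem (Fin d → ℤ) C₀(EuclideanSpace ℝ (Fin n), ℂ) :=
  (affineAction Λ).systemC0.restrict (latticeInclusion d)

/-- The dual system `(C(𝕋ᵈ), ℝⁿ, α̂)` induced by `(y, k) ↦ k - Λ y`. -/
def dualSystem (Λ : Matrix (Fin d) (Fin n) ℝ) :
    CStarSystem (EuclideanSpace ℝ (Fin n)) C(UnitAddTorus (Fin d), ℂ) :=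
  (torusAction Λ).systemC

/-- Counting measure is a Haar measure on `ℤᵈ`. -/
instance : (Measure.count : Measure (Fin d → ℤ)).IsAddHaarMeasure where
  lt_top_of_isCompact := fun K hK =>
    Measure.count_apply_lt_top.2 (isCompact_iff_finite.1 hK)
  map_add_left_eq_self := fun q => by
    ext s hs
    have h : (fun x => q + x) ⁻¹' s = (fun x => -q + x) '' s := by
      rw [Set.image_add_left, neg_neg]
    rw [Measure.map_apply (measurable_const_add q) hs, h,
      Measure.count_injective_image (add_right_injective (-q))]
  open_pos := fun V _ hV => by
    rw [Ne, Measure.count_eq_zero_iff]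
    exact hV.ne_empty

end

/-! On both sides a covariant representation is the same data: a strongly continuous unitary
representation V of ℝⁿ and unitaries U_q representing ℤᵈ, on one Hilbert space, with V_s U_q =
e^{2πi⟨s, Λᵀq⟩} U_q V_s. Fourier duality translates each half. A nondegenerate representation π of
C₀(ℝⁿ) amounts to V, where V_s acts as multiplication by the character y ↦ e^{2πi⟨s, y⟩}
(`UnitaryRep.exists_of_nondegenerate`, `UnitaryRep.exists_nondegenerate`), and then V(g) = ∫ g(s)
V_s ds equals π(𝓕⁻ g). A unitary representation of ℤᵈ amounts to a unital representation of C(𝕋ᵈ)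
sending the monomial e_q to U_q (`exists_starAlgHom_mFourier`). Since ⟨s, Λᵀq⟩ = ⟨Λs, q⟩,
translating a character by Λᵀq and translating e_q by Λs produce the same phase up to sign
conventions, so each covariance condition is the relation above.

The passage from V to π is built by hand: f ↦ ∫ 𝓕f(s) V_s ds is a *-representation of the smooth
compactly supported functions, a square root argument makes it contractive (`norm_smoothC0_rep_le`),
and density extends it to C₀.

The Hilbert space never changes, so pulling back bounded families of operators along `toDual` and
`ofDual` gives *-homomorphisms between the two ambient products. The identity U_q V(g) = π(α_q(𝓕⁻
g)) U_q, with density of the monomials and of the functions 𝓕⁻ g, sends generators into the other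
crossed product. The two maps are mutually inverse on generators, hence on the closed *-algebras
these generate. -/

noncomputable section

open scoped FourierTransform ContDiff Matrix

universe u v

variable {d n : ℕ}

/-! ### Representations of C(𝕋ᵈ) from unitary representations of ℤᵈ -/

/-- A commuting family of unitaries indexed by `ℤᵈ` induces a representation of `C(𝕋ᵈ)`. -/
theorem exists_starAlgHom_mFourier {ι A : Type*} [Fintype ι] [CStarAlgebra A] (w : (ι → ℤ) → A)
    (w_zero : w 0 = 1) (w_add : ∀ p q, w (p + q) = w p * w q)
    (w_star : ∀ q, star (w q) = w (-q)) :
    ∃ σ : C(UnitAddTorus ι, ℂ) →⋆ₐ[ℂ] A, ∀ q, σ (UnitAddTorus.mFourier q) = w q := by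
  classical
  let s : Set A := Set.range w
  have hcomm : ∀ a ∈ s, ∀ b ∈ s, a * b = b * a := by
    rintro _ ⟨p, rfl⟩ _ ⟨q, rfl⟩
    rw [← w_add, ← w_add, add_comm]
  have hstar : ∀ a ∈ s, ∀ b ∈ s, a * star b = star b * a := by
    rintro _ ⟨p, rfl⟩ _ ⟨q, rfl⟩
    rw [w_star, ← w_add, ← w_add, add_comm]
  -- The closed unital *-algebra generated by the w q is commutative, so Gelfand duality applies; σ
  -- is dual to a continuous map from its character space to the torus.
  let S₀ := StarAlgebra.adjoin ℂ s
  let S : StarSubalgebra ℂ A := S₀.topologicalClosure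
  have hS : IsClosed (S : Set A) := S₀.isClosed_topologicalClosure
  have hmem : ∀ q, w q ∈ S := fun q =>
    S₀.le_topologicalClosure (StarAlgebra.subset_adjoin ℂ s ⟨q, rfl⟩)
  have c₀ := StarAlgebra.isMulCommutative_adjoin ℂ hcomm hstar
  have hcommS : ∀ x y : S, x * y = y * x := by
    let := S₀.commRingTopologicalClosure (fun x y => c₀.is_comm.comm x y)
    exact fun x y => mul_comm x y
  let : CommCStarAlgebra S := { (inferInstance : CStarAlgebra S) with mul_comm := hcommS }
  let w' : (ι → ℤ) → S := fun q => ⟨w q, hmem q⟩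
  have w'_zero : w' 0 = 1 := Subtype.ext w_zero
  have w'_add : ∀ p q, w' (p + q) = w' p * w' q := fun p q => Subtype.ext (w_add p q)
  have hnorm : ∀ (φ : WeakDual.characterSpace ℂ S) (q : ι → ℤ), ‖φ (w' q)‖ = 1 := by
    intro φ q
    have h : star (w' q) * w' q = 1 := by
      have : star (w' q) = w' (-q) := Subtype.ext (w_star q)
      rw [this, ← w'_add, neg_add_cancel, w'_zero]
    have h' := congrArg φ h
    rw [map_mul, map_star, map_one] at h'
    have h'' := congrArg norm h'
    rw [norm_mul, norm_star, norm_one] at h''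
    nlinarith [norm_nonneg (φ (w' q))]
  let χ : WeakDual.characterSpace ℂ S → (ι → ℤ) → Circle := fun φ q =>
    ⟨φ (w' q), by simpa [Submonoid.unitSphere] using hnorm φ q⟩
  let t : WeakDual.characterSpace ℂ S → UnitAddTorus ι := fun φ i =>
    (AddCircle.homeomorphCircle one_ne_zero).symm (χ φ (Pi.single i 1))
  have ht : Continuous t := by
    refine continuous_pi fun i => (Homeomorph.continuous _).comp ?_
    refine Continuous.subtype_mk ?_ _
    exact (WeakDual.eval_continuous _).comp continuous_subtype_val
  have htχ : ∀ φ q, UnitAddTorus.mFourier q (t φ) = φ (w' q) := by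
    intro φ q
    -- Both sides turn sums in q into products, so it suffices to compare them on the standard
    -- basis, where the definition of `t` gives equality.
    let f₁ : (ι → ℤ) →+ Additive ℂ :=
      { toFun := fun q => Additive.ofMul (UnitAddTorus.mFourier q (t φ))
        map_zero' := by rw [UnitAddTorus.mFourier_zero]; rfl
        map_add' := fun p q => by rw [UnitAddTorus.mFourier_add]; rfl }
    let f₂ : (ι → ℤ) →+ Additive ℂ :=
      { toFun := fun q => Additive.ofMul (φ (w' q))
        map_zero' := by rw [w'_zero, map_one]; rfl
        map_add' := fun p q => by rw [w'_add, map_mul]; rfl }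
    suffices f₁ = f₂ from congrArg Additive.toMul (DFunLike.congr_fun this q)
    refine AddMonoidHom.functions_ext' _ _ _ fun i => ?_
    refine AddMonoidHom.ext_int ?_
    change Additive.ofMul (UnitAddTorus.mFourier (Pi.single i 1) (t φ)) =
      Additive.ofMul (φ (w' (Pi.single i 1)))
    rw [UnitAddTorus.mFourier_single, fourier_one]
    simp only [t]
    rw [← AddCircle.homeomorphCircle_apply one_ne_zero, Homeomorph.apply_symm_apply]
  let σ : C(UnitAddTorus ι, ℂ) →⋆ₐ[ℂ] S :=
    ((gelfandStarTransform S).symm : C(WeakDual.characterSpace ℂ S, ℂ) →⋆ₐ[ℂ] S).comp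
      (ContinuousMap.compStarAlgHom' ℂ ℂ ⟨t, ht⟩)
  refine ⟨S.subtype.comp σ, fun q => ?_⟩
  have : σ (UnitAddTorus.mFourier q) = w' q := by
    apply (gelfandStarTransform S).injective
    ext φ
    change gelfandStarTransform S ((gelfandStarTransform S).symm
      ((UnitAddTorus.mFourier q).comp ⟨t, ht⟩)) φ = _
    rw [StarAlgEquiv.apply_symm_apply]
    exact htχ φ q
  simp [this, w']

/-! ### Characters, smooth functions and Fourier inversion in C₀(E) -/

namespace ZeroAtInftyContinuousMap

variable {E : Type*} [NormedAddCommGroup E] [InnerProductSpace ℝ E]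

theorem norm_le_of_forall {X : Type*} [TopologicalSpace X] (a : C₀(X, ℂ)) {C : ℝ} (hC : 0 ≤ C)
    (h : ∀ x, ‖a x‖ ≤ C) : ‖a‖ ≤ C := by
  rw [← norm_toBCF_eq_norm]
  exact (BoundedContinuousFunction.norm_le hC).2 h

theorem norm_apply_le {X : Type*} [TopologicalSpace X] (a : C₀(X, ℂ)) (x : X) : ‖a x‖ ≤ ‖a‖ := by
  rw [← norm_toBCF_eq_norm]
  exact a.toBCF.norm_coe_le_norm x

/-- Multiplication of `a` by the character `y ↦ exp (2πi ⟪s, y⟫)`. -/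
def charMul (s : E) (a : C₀(E, ℂ)) : C₀(E, ℂ) where
  toFun y := (𝐞 (inner ℝ s y) : ℂ) * a y
  continuous_toFun := by
    refine Continuous.mul ?_ a.continuous
    exact continuous_subtype_val.comp (Real.continuous_fourierChar.comp (by fun_prop))
  zero_at_infty' := by
    rw [tendsto_zero_iff_norm_tendsto_zero]
    simpa only [norm_mul, Circle.norm_coe, one_mul, norm_zero] using (zero_at_infty a).norm

@[simp] theorem charMul_apply (s : E) (a : C₀(E, ℂ)) (y : E) :
    charMul s a y = (𝐞 (inner ℝ s y) : ℂ) * a y := rfl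

theorem charMul_zero (a : C₀(E, ℂ)) : charMul 0 a = a := by
  ext y; simp

theorem charMul_add (s t : E) (a : C₀(E, ℂ)) : charMul (s + t) a = charMul s (charMul t a) := by
  ext y
  simp [inner_add_left, AddChar.map_add_eq_mul, mul_assoc]

/-- The phases cancel. Consequently multiplication by a character preserves the inner products of
the vectors π(a)ξ, which makes it unitary in any representation. -/
theorem star_charMul_mul_charMul (s : E) (a b : C₀(E, ℂ)) :
    star (charMul s a) * charMul s b = star a * b := by
  ext y
  have h : (starRingEnd ℂ) (𝐞 (inner ℝ s y) : ℂ) * (𝐞 (inner ℝ s y) : ℂ) = 1 := by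
    rw [← Complex.normSq_eq_conj_mul_self, Circle.normSq_coe]; simp
  simp only [mul_apply, star_apply, charMul_apply, star_mul', RCLike.star_def]
  linear_combination (starRingEnd ℂ (a y) * b y) * h

theorem norm_charMul (s : E) (a : C₀(E, ℂ)) : ‖charMul s a‖ = ‖a‖ := by
  refine le_antisymm (norm_le_of_forall _ (norm_nonneg _) fun y => ?_)
    (norm_le_of_forall _ (norm_nonneg _) fun y => ?_)
  · simpa only [charMul_apply, norm_mul, Circle.norm_coe, one_mul] using norm_apply_le a y
  · simpa only [charMul_apply, norm_mul, Circle.norm_coe, one_mul] using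
      norm_apply_le (charMul s a) y

theorem dist_charMul (s : E) (a b : C₀(E, ℂ)) : dist (charMul s a) (charMul s b) = dist a b := by
  rw [dist_eq_norm, dist_eq_norm, ← norm_charMul s (a - b)]
  congr 1
  ext y; simp [mul_sub]

theorem isometry_charMul (s : E) : Isometry (charMul s) := Isometry.of_dist_eq (dist_charMul s)

/-- Off a compact set `a` is below ε/2, so the two functions differ by less than ε there; on the
compact set joint continuity gives uniform closeness. -/
theorem continuous_charMul_left (a : C₀(E, ℂ)) : Continuous fun s => charMul s a := by
  rw [continuous_iff_continuousAt]
  intro s₀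
  rw [ContinuousAt, tendsto_iff_tendstoUniformly, Metric.tendstoUniformly_iff]
  intro ε hε
  obtain ⟨K, hKc, hK⟩ : ∃ K : Set E, IsCompact K ∧ Kᶜ ⊆ {x | ‖a x‖ < ε / 2} := by
    have h := (zero_at_infty a).norm
    rw [norm_zero] at h
    exact mem_cocompact.1 (h.eventually (gt_mem_nhds (half_pos hε)))
  have hcont : Continuous fun p : E × E => charMul p.1 a p.2 := by
    simp only [charMul_apply]
    refine Continuous.mul ?_ (a.continuous.comp continuous_snd)
    exact continuous_subtype_val.comp (Real.continuous_fourierChar.comp (by fun_prop))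
  have hunif : ∀ᶠ s in 𝓝 s₀, ∀ x ∈ K, dist (charMul s₀ a x) (charMul s a x) < ε := by
    refine hKc.eventually_forall_of_forall_eventually fun x _ => ?_
    have h1 : Continuous fun p : E × E => dist (charMul s₀ a p.2) (charMul p.1 a p.2) :=
      (hcont.comp (continuous_const.prodMk continuous_snd)).dist hcont
    have h2 := h1.tendsto (s₀, x)
    simp only [dist_self] at h2
    exact h2.eventually (gt_mem_nhds hε)
  filter_upwards [hunif] with s hs x
  by_cases hx : x ∈ K
  · exact hs x hx
  · have h : ‖a x‖ < ε / 2 := hK hx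
    rw [dist_eq_norm]
    refine (norm_sub_le _ _).trans_lt ?_
    simp only [charMul_apply, norm_mul, Circle.norm_coe, one_mul]
    linarith

/-- The smooth compactly supported functions, as a *-subalgebra of `C₀(E)`. -/
def smoothC0 (E : Type*) [NormedAddCommGroup E] [InnerProductSpace ℝ E] :
    NonUnitalStarSubalgebra ℂ C₀(E, ℂ) where
  carrier := {f | ContDiff ℝ ∞ f ∧ HasCompactSupport f}
  add_mem' hf hg := ⟨hf.1.add hg.1, hf.2.add hg.2⟩
  zero_mem' := ⟨contDiff_const, HasCompactSupport.zero⟩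
  mul_mem' hf hg := ⟨hf.1.mul hg.1, hf.2.mul_right⟩
  smul_mem' c _ hf := ⟨contDiff_const.smul hf.1, hf.2.smul_left (f := fun _ => c)⟩
  star_mem' hf := ⟨Complex.conjCLE.contDiff.comp hf.1, hf.2.comp_left (g := star) (star_zero ℂ)⟩

/-- A smooth compactly supported function, as an element of `smoothC0 E`. -/
def smoothC0.mk (f : E → ℂ) (hf : ContDiff ℝ ∞ f) (hc : HasCompactSupport f) : smoothC0 E :=
  ⟨⟨⟨f, hf.continuous⟩, hc.is_zero_at_infty⟩, hf, hc⟩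

/-- A smooth compactly supported function, as a Schwartz function. -/
def smoothC0.toSchwartz (f : smoothC0 E) : SchwartzMap E ℂ := f.2.2.toSchwartzMap f.2.1

variable [FiniteDimensional ℝ E]

/-- Cut `a` off by a compactly supported χ equal to 1 where `a` is not small, then approximate χa
uniformly by a smooth function with support inside that of χa. -/
theorem dense_smoothC0 : Dense (smoothC0 E : Set C₀(E, ℂ)) := by
  intro a
  rw [Metric.mem_closure_iff]
  intro ε hε
  obtain ⟨K, hKc, hK⟩ : ∃ K : Set E, IsCompact K ∧ Kᶜ ⊆ {x | ‖a x‖ < ε / 3} := by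
    have h := (zero_at_infty a).norm
    rw [norm_zero] at h
    exact mem_cocompact.1 (h.eventually (gt_mem_nhds (by positivity)))
  obtain ⟨χ, hχ1, -, hχc, hχ⟩ :=
    exists_continuous_one_zero_of_isCompact hKc isClosed_empty (Set.disjoint_empty K)
  obtain ⟨g, hg, hgd, hgs⟩ := Continuous.exists_contDiff_approx (f := fun x => (χ x : ℂ) * a x)
    (ε := fun _ => ε / 3) ⊤ (by fun_prop) continuous_const (fun _ => by positivity)
  have hc : HasCompactSupport fun x => (χ x : ℂ) * a x :=
    (hχc.comp_left (g := fun r : ℝ => (r : ℂ)) Complex.ofReal_zero).mul_right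
  have hgc : HasCompactSupport g := hc.mono hgs
  refine ⟨smoothC0.mk g hg hgc, (smoothC0.mk g hg hgc).2, ?_⟩
  rw [dist_eq_norm]
  refine (norm_le_of_forall _ (C := 2 * (ε / 3)) (by positivity) fun x => ?_).trans_lt
    (by linarith)
  have h1 : ‖g x - χ x * a x‖ < ε / 3 := by simpa [dist_eq_norm] using hgd x
  have h2 : ‖a x - χ x * a x‖ ≤ ε / 3 := by
    by_cases hx : x ∈ K
    · simp [hχ1 hx]; positivity
    · have : a x - χ x * a x = ((1 - χ x : ℝ) : ℂ) * a x := by push_cast; ring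
      rw [this, norm_mul, Complex.norm_real, Real.norm_of_nonneg (by linarith [(hχ x).2])]
      have h3 : ‖a x‖ < ε / 3 := hK hx
      nlinarith [(hχ x).1, norm_nonneg (a x)]
  change ‖a x - g x‖ ≤ _
  have : a x - g x = (a x - χ x * a x) - (g x - χ x * a x) := by ring
  rw [this]
  exact (norm_sub_le _ _).trans (by linarith)

variable [MeasurableSpace E] [BorelSpace E]

/-- The inverse Fourier transform of a function, as a continuous function vanishing at infinity. -/
def fourierInvC0 (g : E → ℂ) : C₀(E, ℂ) where
  toFun := 𝓕⁻ g
  continuous_toFun := by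
    by_cases hg : Integrable g
    · rw [show 𝓕⁻ g = fun w => 𝓕 g (-w) from funext (Real.fourierInv_eq_fourier_neg g)]
      refine Continuous.comp (g := 𝓕 g) ?_ continuous_neg
      exact VectorFourier.fourierIntegral_continuous Real.continuous_fourierChar
        (innerSL ℝ).continuous₂ hg
    -- For non-integrable g the Bochner integral takes its default value 0, so the definition needs
    -- no hypothesis on g.
    · have : 𝓕⁻ g = 0 := by
        ext w
        rw [Real.fourierInv_eq_fourier_neg, Real.fourier_eq, integral_undef, Pi.zero_apply]
        rwa [Real.fourierIntegral_convergent_iff]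
      rw [this]; exact continuous_zero
  zero_at_infty' := by
    rw [show 𝓕⁻ g = fun w => 𝓕 g (-w) from funext (Real.fourierInv_eq_fourier_neg g)]
    refine Tendsto.comp (g := 𝓕 g) (y := cocompact E) ?_ ?_
    · exact tendsto_integral_exp_inner_smul_cocompact g
    · exact (Homeomorph.neg E).isClosedEmbedding.tendsto_cocompact

theorem fourierInvC0_apply (g : E → ℂ) (w : E) : fourierInvC0 g w = 𝓕⁻ g w := rfl

theorem norm_fourierInvC0_sub_le {f g : E → ℂ} (hf : Integrable f) (hg : Integrable g) :
    ‖fourierInvC0 f - fourierInvC0 g‖ ≤ ∫ s, ‖f s - g s‖ := by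
  refine norm_le_of_forall _ (integral_nonneg fun _ => norm_nonneg _) fun w => ?_
  rw [sub_apply, fourierInvC0_apply, fourierInvC0_apply, Real.fourierInv_eq_fourier_neg,
    Real.fourierInv_eq_fourier_neg, Real.fourier_eq, Real.fourier_eq, ← integral_sub]
  · refine (norm_integral_le_integral_norm _).trans (le_of_eq ?_)
    simp_rw [← smul_sub, Circle.norm_smul]
  · rwa [Real.fourierIntegral_convergent_iff]
  · rwa [Real.fourierIntegral_convergent_iff]

theorem integrable_smul_charMul {g : E → ℂ} (hg : Integrable g) (a : C₀(E, ℂ)) :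
    Integrable fun s => g s • charMul s a := by
  refine Integrable.mono' (hg.norm.mul_const ‖a‖)
    (hg.aestronglyMeasurable.smul (continuous_charMul_left a).aestronglyMeasurable) ?_
  filter_upwards with s
  rw [norm_smul, norm_charMul]

/-- Evaluation at a point, as a continuous linear functional. -/
def evalC0 (y : E) : C₀(E, ℂ) →L[ℂ] ℂ :=
  LinearMap.mkContinuous
    { toFun := fun a => a y
      map_add' := fun _ _ => rfl
      map_smul' := fun _ _ => rfl }
    1 fun a => by simpa using norm_apply_le a y

/-- Evaluation at y commutes with the integral and yields the defining integral of 𝓕⁻ g at y. This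
is the function-level form of V(g) = π(𝓕⁻ g). -/
theorem integral_smul_charMul {g : E → ℂ} (hg : Integrable g) (a : C₀(E, ℂ)) :
    ∫ s, g s • charMul s a = fourierInvC0 g * a := by
  ext y
  change evalC0 y (∫ s, g s • charMul s a) = _
  rw [← ContinuousLinearMap.integral_comp_comm _ (integrable_smul_charMul hg a), mul_apply,
    fourierInvC0_apply, Real.fourierInv_eq, ← integral_mul_const]
  refine integral_congr_ae (ae_of_all _ fun s => ?_)
  change g s * ((𝐞 (inner ℝ s y) : ℂ) * a y) = _
  simp only [Circle.smul_def, smul_eq_mul]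
  ring

theorem smoothC0.integrable (f : smoothC0 E) : Integrable ⇑(f : C₀(E, ℂ)) :=
  (smoothC0.toSchwartz f).integrable

theorem smoothC0.integrable_fourier (f : smoothC0 E) : Integrable (𝓕 ⇑(f : C₀(E, ℂ))) :=
  (𝓕 (smoothC0.toSchwartz f)).integrable

theorem smoothC0.fourierInvC0_fourier (f : smoothC0 E) :
    fourierInvC0 (𝓕 ⇑(f : C₀(E, ℂ))) = f := by
  ext y
  exact congrFun ((map_continuous (f : C₀(E, ℂ))).fourierInv_fourier_eq
    (smoothC0.integrable f) (smoothC0.integrable_fourier f)) y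

/-- A smooth compactly supported a equals 𝓕⁻(𝓕 a) with 𝓕 a integrable. Approximating 𝓕 a in L¹ by
C_c functions suffices, because 𝓕⁻ is contractive from L¹ to the uniform norm. -/
theorem dense_range_fourierInvC0 : DenseRange fun g : C_c(E, ℂ) => fourierInvC0 ⇑g := by
  rw [DenseRange, ← dense_closure]
  refine dense_smoothC0.mono fun a ha => ?_
  lift a to smoothC0 E using ha
  rw [Metric.mem_closure_iff]
  intro ε hε
  obtain ⟨g, hgc, hg, hgcont, hgi⟩ :=
    (smoothC0.integrable_fourier a).exists_hasCompactSupport_integral_sub_le (half_pos hε)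
  refine ⟨_, ⟨⟨⟨g, hgcont⟩, hgc⟩, rfl⟩, ?_⟩
  rw [dist_eq_norm, ← (smoothC0.fourierInvC0_fourier a)]
  refine (norm_fourierInvC0_sub_le (smoothC0.integrable_fourier a) hgi).trans_lt ?_
  exact hg.trans_lt (half_lt_self hε)

end ZeroAtInftyContinuousMap

/-! ### Automatic contractivity and extension from dense *-subalgebras -/

/-- A contractive *-homomorphism on a dense *-subalgebra extends to the whole algebra. -/
theorem NonUnitalStarSubalgebra.exists_extension {A B : Type*} [NonUnitalCStarAlgebra A]
    [NonUnitalCStarAlgebra B] (D : NonUnitalStarSubalgebra ℂ A) (hD : Dense (D : Set A))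
    (φ : D →⋆ₙₐ[ℂ] B) (hφ : ∀ x : D, ‖φ x‖ ≤ ‖(x : A)‖) :
    ∃ Φ : A →⋆ₙₐ[ℂ] B, ∀ x : D, Φ x = φ x := by
  let e : D →ₗ[ℂ] A := D.toSubmodule.subtype
  let f : D →ₗ[ℂ] B := { toFun := φ, map_add' := map_add φ, map_smul' := map_smul φ }
  have he : DenseRange e := by
    rw [DenseRange, show Set.range e = (D : Set A) from Subtype.range_coe]
    exact hD
  let Φ : A →L[ℂ] B := f.extendOfNorm e
  have hΦ : ∀ x : D, Φ x = φ x := fun x =>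
    f.extendOfNorm_eq he ⟨1, fun y => by rw [one_mul]; exact hφ y⟩ x
  refine ⟨
    { toFun := Φ
      map_smul' := map_smul Φ
      map_zero' := map_zero Φ
      map_add' := map_add Φ
      map_mul' := fun x y => ?_
      map_star' := fun x => ?_ }, hΦ⟩
  · refine hD.induction (P := fun x => ∀ y, Φ (x * y) = Φ x * Φ y) (fun x hx y => ?_) ?_ x y
    · refine hD.induction (P := fun y => Φ (x * y) = Φ x * Φ y) (fun y hy => ?_) ?_ y
      · have h := hΦ (⟨x, hx⟩ * ⟨y, hy⟩)
        rw [map_mul, ← hΦ, ← hΦ] at h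
        exact h
      · exact isClosed_eq (by fun_prop) (by fun_prop)
    · simp only [Set.ofPred_forall]
      exact isClosed_iInter fun y => isClosed_eq (by fun_prop) (by fun_prop)
  · refine hD.induction (P := fun x => Φ (star x) = star (Φ x)) (fun x hx => ?_) ?_ x
    · have h := hΦ (star ⟨x, hx⟩)
      rw [map_star, ← hΦ] at h
      exact h
    · exact isClosed_eq (by fun_prop) (by fun_prop)

namespace ZeroAtInftyContinuousMap

variable {E : Type*} [NormedAddCommGroup E] [InnerProductSpace ℝ E]
variable {H : Type*} [NormedAddCommGroup H] [InnerProductSpace ℂ H] [CompleteSpace H]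

/-- The relation is 1 - f*f = (1 - h)² written without a unit, so h = 1 - √(1 - |f|²). The strict
bound |f| < 1 keeps the square root smooth, and h vanishes where f does. -/
theorem exists_smoothC0_sqrt (f : smoothC0 E) (hf : ‖(f : C₀(E, ℂ))‖ < 1) :
    ∃ h : smoothC0 E, star h = h ∧ star f * f + h * h = h + h := by
  set F : E → ℂ := ⇑(f : C₀(E, ℂ)) with hF
  have hlt : ∀ y, ‖F y‖ ^ 2 < 1 := fun y => by
    have := (norm_apply_le (f : C₀(E, ℂ)) y).trans_lt hf
    rw [sq_lt_one_iff₀ (norm_nonneg _)]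
    exact this
  have hsmooth : ContDiff ℝ ∞ fun y => ((1 - √(1 - ‖F y‖ ^ 2) : ℝ) : ℂ) := by
    refine Complex.ofRealCLM.contDiff.comp (contDiff_const.sub ?_)
    refine ContDiff.sqrt (contDiff_const.sub (f.2.1.norm_sq ℝ)) fun y => ?_
    exact (sub_pos.2 (hlt y)).ne'
  have hcomp : HasCompactSupport fun y => ((1 - √(1 - ‖F y‖ ^ 2) : ℝ) : ℂ) :=
    f.2.2.comp_left (g := fun z : ℂ => ((1 - √(1 - ‖z‖ ^ 2) : ℝ) : ℂ)) (by simp)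
  refine ⟨smoothC0.mk _ hsmooth hcomp, ?_, ?_⟩
  · apply Subtype.ext
    ext y
    exact Complex.conj_ofReal _
  · apply Subtype.ext
    ext y
    change (starRingEnd ℂ) (F y) * F y +
      ((1 - √(1 - ‖F y‖ ^ 2) : ℝ) : ℂ) * ((1 - √(1 - ‖F y‖ ^ 2) : ℝ) : ℂ) =
      ((1 - √(1 - ‖F y‖ ^ 2) : ℝ) : ℂ) + ((1 - √(1 - ‖F y‖ ^ 2) : ℝ) : ℂ)
    rw [Complex.conj_mul']
    norm_cast
    have := Real.sq_sqrt (sub_pos.2 (hlt y)).le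
    linear_combination this

/-- Every *-representation of the smooth compactly supported functions is contractive for the
uniform norm. -/
theorem norm_smoothC0_rep_le (φ : smoothC0 E →⋆ₙₐ[ℂ] (H →L[ℂ] H)) (f : smoothC0 E) :
    ‖φ f‖ ≤ ‖(f : C₀(E, ℂ))‖ := by
  have key : ∀ f : smoothC0 E, ‖(f : C₀(E, ℂ))‖ < 1 → ‖φ f‖ ≤ 1 := by
    intro f hf
    obtain ⟨h, hstar, hh⟩ := exists_smoothC0_sqrt f hf
    refine ContinuousLinearMap.opNorm_le_bound _ zero_le_one fun ξ => ?_
    have hadj : ∀ η ζ, inner ℂ (φ h η) ζ = inner ℂ η (φ h ζ) := fun η ζ => by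
      conv_rhs => rw [← hstar, map_star, ContinuousLinearMap.star_eq_adjoint,
        ContinuousLinearMap.adjoint_inner_right]
    -- The relation for h gives ‖φ(f)ξ‖² = ‖ξ‖² - ‖ξ - φ(h)ξ‖², which is at most ‖ξ‖².
    have h1 : inner ℂ (φ f ξ) (φ f ξ) =
        inner ℂ ξ (φ h ξ) + inner ℂ ξ (φ h ξ) - inner ℂ (φ h ξ) (φ h ξ) := by
      rw [← ContinuousLinearMap.adjoint_inner_right, ← ContinuousLinearMap.star_eq_adjoint,
        ← map_star]
      have h2 : φ (star f) (φ f ξ) = φ (star f * f) ξ := by rw [map_mul]; rfl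
      have h3 := congrArg (fun T => inner ℂ ξ (T ξ)) ((congrArg φ hh).trans (map_add φ h h))
      simp only [map_add, map_mul φ h h, _root_.add_apply,
        mul_apply_eq_comp, inner_add_right] at h3
      rw [h2, hadj ξ (φ h ξ), ← h3]
      ring
    have h3 : ‖φ f ξ‖ ^ 2 = 2 * RCLike.re (inner ℂ ξ (φ h ξ)) - ‖φ h ξ‖ ^ 2 := by
      have := congrArg RCLike.re h1
      simp only [inner_self_eq_norm_sq, map_sub, map_add] at this
      rw [this]; ring
    have h4 := norm_sub_sq (𝕜 := ℂ) ξ (φ h ξ)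
    rw [one_mul]
    refine le_of_sq_le_sq ?_ (norm_nonneg _)
    nlinarith [sq_nonneg ‖ξ - φ h ξ‖]
  refine le_of_forall_gt_imp_ge_of_dense fun c hc => ?_
  have hc0 : 0 < c := (norm_nonneg _).trans_lt hc
  have h := key ((c⁻¹ : ℂ) • f) (by
    change ‖(c⁻¹ : ℂ) • (f : C₀(E, ℂ))‖ < 1
    rw [norm_smul, norm_inv, Complex.norm_real, Real.norm_of_nonneg hc0.le]
    rwa [inv_mul_lt_one₀ hc0])
  rw [map_smul, norm_smul, norm_inv, Complex.norm_real, Real.norm_of_nonneg hc0.le,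
    inv_mul_le_one₀ hc0] at h
  exact h

theorem exists_extension_smoothC0 [FiniteDimensional ℝ E]
    (φ : smoothC0 E →⋆ₙₐ[ℂ] (H →L[ℂ] H)) :
    ∃ π : C₀(E, ℂ) →⋆ₙₐ[ℂ] (H →L[ℂ] H), ∀ f : smoothC0 E, π f = φ f :=
  (smoothC0 E).exists_extension dense_smoothC0 φ (norm_smoothC0_rep_le φ)

end ZeroAtInftyContinuousMap

/-! ### The Fourier transform under modulation, star and products -/

namespace ZeroAtInftyContinuousMap

variable {E : Type*} [NormedAddCommGroup E] [InnerProductSpace ℝ E]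

theorem charMul_mem_smoothC0 (s : E) {f : C₀(E, ℂ)} (hf : f ∈ smoothC0 E) :
    charMul s f ∈ smoothC0 E := by
  refine ⟨ContDiff.mul (𝕜 := ℝ) ?_ hf.1, hf.2.mul_left⟩
  simp only [Real.fourierChar_apply]
  refine ContDiff.cexp (ContDiff.mul (Complex.ofRealCLM.contDiff.comp ?_) contDiff_const)
  exact contDiff_const.mul (contDiff_const.inner ℝ contDiff_id)

variable [FiniteDimensional ℝ E] [MeasurableSpace E] [BorelSpace E]

theorem fourier_charMul (s t : E) (f : C₀(E, ℂ)) :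
    𝓕 ⇑(charMul s f) t = 𝓕 ⇑f (t - s) := by
  rw [Real.fourier_eq, Real.fourier_eq]
  refine integral_congr_ae (ae_of_all _ fun y => ?_)
  simp only [charMul_apply, Circle.smul_def, smul_eq_mul]
  rw [← mul_assoc, ← Circle.coe_mul, ← AddChar.map_add_eq_mul, inner_sub_right, neg_sub,
    real_inner_comm s y]
  congr 3
  ring

theorem fourier_star (f : C₀(E, ℂ)) (t : E) :
    𝓕 ⇑(star f) t = (starRingEnd ℂ) (𝓕 ⇑f (-t)) := by
  rw [Real.fourier_eq, Real.fourier_eq, ← integral_conj]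
  refine integral_congr_ae (ae_of_all _ fun y => ?_)
  simp only [star_apply, Circle.smul_def, smul_eq_mul, map_mul, inner_neg_right, neg_neg,
    ← Circle.coe_inv_eq_conj, ← AddChar.map_neg_eq_inv, RCLike.star_def]

/-- Symmetry of 𝓕⁻ under the pairing ∫ uv, applied to u = 𝓕f and to v = h times the character at -t:
the inverse transform of v is s ↦ 𝓕h(t - s). -/
theorem fourier_mul_smoothC0 (f h : smoothC0 E) (t : E) :
    𝓕 ⇑((f : C₀(E, ℂ)) * h) t =
      ∫ s, 𝓕 ⇑(f : C₀(E, ℂ)) s * 𝓕 ⇑(h : C₀(E, ℂ)) (t - s) := by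
  let k : smoothC0 E := ⟨charMul (-t) h, charMul_mem_smoothC0 _ h.2⟩
  have hk : ∀ s, 𝓕 ⇑(h : C₀(E, ℂ)) (t - s) = 𝓕⁻ (smoothC0.toSchwartz k) s := fun s => by
    rw [SchwartzMap.fourierInv_coe, Real.fourierInv_eq_fourier_neg]
    change _ = 𝓕 ⇑(charMul (-t) (h : C₀(E, ℂ))) (-s)
    rw [fourier_charMul]
    abel_nf
  simp_rw [hk]
  have := SchwartzMap.integral_fourierInv_mul_eq (𝓕 (smoothC0.toSchwartz f))
    (smoothC0.toSchwartz k)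
  refine Eq.trans ?_ this
  rw [FourierTransform.fourierInv_fourier_eq, Real.fourier_eq]
  refine integral_congr_ae (ae_of_all _ fun y => ?_)
  change _ = f.1 y * charMul (-t) h.1 y
  simp only [charMul_apply, mul_apply, Circle.smul_def, smul_eq_mul, inner_neg_left,
    real_inner_comm t y]
  ring

end ZeroAtInftyContinuousMap

/-! ### Unitary representations of E and their integrated forms -/

open ZeroAtInftyContinuousMap

/-- A strongly continuous unitary representation of `E` on `H`. -/
structure UnitaryRep (E H : Type*) [NormedAddCommGroup E] [NormedAddCommGroup H]
    [InnerProductSpace ℂ H] where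
  /-- the unitary operator attached to a vector -/
  toFun : E → (H ≃ₗᵢ[ℂ] H)
  map_zero' : ∀ ξ, toFun 0 ξ = ξ
  map_add' : ∀ s t ξ, toFun (s + t) ξ = toFun s (toFun t ξ)
  continuous' : ∀ ξ, Continuous fun s => toFun s ξ

namespace UnitaryRep

variable {E H : Type*} [NormedAddCommGroup E] [NormedAddCommGroup H]
  [InnerProductSpace ℂ H]

instance : CoeFun (UnitaryRep E H) fun _ => E → (H ≃ₗᵢ[ℂ] H) := ⟨toFun⟩

variable (V : UnitaryRep E H)

theorem inner_map_left (s : E) (ξ η : H) : inner ℂ (V s ξ) η = inner ℂ ξ (V (-s) η) := by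
  rw [← (V s).inner_map_map ξ (V (-s) η), ← V.map_add', add_neg_cancel, V.map_zero']

variable [InnerProductSpace ℝ E] [FiniteDimensional ℝ E] [MeasurableSpace E] [BorelSpace E]

theorem integrable_smul {g : E → ℂ} (hg : Integrable g) (ξ : H) :
    Integrable fun s => g s • V s ξ := by
  refine Integrable.mono' (hg.norm.mul_const ‖ξ‖)
    (hg.aestronglyMeasurable.smul (V.continuous' ξ).aestronglyMeasurable) ?_
  filter_upwards with s
  rw [norm_smul, LinearIsometryEquiv.norm_map]

/-- The operator `∫ g(s) V_s ds`, as a strong integral. -/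
def integral {g : E → ℂ} (hg : Integrable g) : H →L[ℂ] H :=
  LinearMap.mkContinuous
    { toFun := fun ξ => ∫ s, g s • V s ξ
      map_add' := fun ξ η => by
        simp_rw [map_add, smul_add]
        exact integral_add (V.integrable_smul hg ξ) (V.integrable_smul hg η)
      map_smul' := fun c ξ => by
        simp_rw [map_smul, smul_comm _ c]
        exact integral_smul c _ }
    (∫ s, ‖g s‖) (fun ξ => by
      refine (norm_integral_le_integral_norm _).trans (le_of_eq ?_)
      simp_rw [norm_smul, LinearIsometryEquiv.norm_map]
      exact integral_mul_const _ _)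

theorem integral_apply {g : E → ℂ} (hg : Integrable g) (ξ : H) :
    V.integral hg ξ = ∫ s, g s • V s ξ := rfl

/-- Translating the integration variable by s matches the translation of 𝓕f caused by the character
at s. -/
theorem map_integral (s : E) (f : smoothC0 E) (ξ : H) :
    V s (V.integral (smoothC0.integrable_fourier f) ξ) =
      V.integral (smoothC0.integrable_fourier ⟨charMul s f, charMul_mem_smoothC0 s f.2⟩) ξ := by
  simp only [integral_apply]
  have h1 : V s (∫ t, 𝓕 ⇑(f : C₀(E, ℂ)) t • V t ξ) =
      ∫ t, V s (𝓕 ⇑(f : C₀(E, ℂ)) t • V t ξ) :=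
    ((V s).toContinuousLinearEquiv.integral_comp_comm _).symm
  rw [h1]
  conv_rhs => rw [← integral_add_right_eq_self _ s]
  refine integral_congr_ae (ae_of_all _ fun t => ?_)
  simp only [map_smul, fourier_charMul, ← V.map_add', add_sub_cancel_right, add_comm s t]

variable [CompleteSpace H]

theorem inner_integral_left {g g' : E → ℂ} (hg : Integrable g) (hg' : Integrable g')
    (h : ∀ s, g' s = (starRingEnd ℂ) (g (-s))) (ξ η : H) :
    inner ℂ (V.integral hg ξ) η = inner ℂ ξ (V.integral hg' η) := by
  rw [← inner_conj_symm, integral_apply, integral_apply,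
    ← _root_.integral_inner (V.integrable_smul hg ξ),
    ← _root_.integral_inner (V.integrable_smul hg' η), ← integral_conj,
    ← integral_neg_eq_self]
  refine integral_congr_ae (ae_of_all _ fun s => ?_)
  simp only [inner_smul_right, h, map_mul, inner_conj_symm]
  rw [V.inner_map_left, neg_neg]

/-- The representation `f ↦ ∫ 𝓕 f(s) V_s ds` of the smooth compactly supported functions. -/
def smoothRep : smoothC0 E →⋆ₙₐ[ℂ] (H →L[ℂ] H) where
  toFun f := V.integral (smoothC0.integrable_fourier f)
  map_smul' c f := by
    ext ξ
    change ∫ s, 𝓕 ⇑(c • smoothC0.toSchwartz f) s • V s ξ = c • ∫ s, 𝓕 ⇑(f : C₀(E, ℂ)) s • V s ξ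
    rw [← integral_smul]
    refine integral_congr_ae (ae_of_all _ fun s => ?_)
    have h := congrArg (fun k : SchwartzMap E ℂ => k s)
      (FourierTransform.fourier_smul c (smoothC0.toSchwartz f))
    exact (congrArg (· • V s ξ) h).trans (by rw [_root_.smul_apply, smul_assoc]; rfl)
  map_zero' := by
    ext ξ
    change ∫ s, 𝓕 ⇑(0 : SchwartzMap E ℂ) s • V s ξ = 0
    rw [← SchwartzMap.fourier_coe, FourierTransform.fourier_zero]
    simp
  map_add' f h := by
    ext ξ
    change _ = (∫ s, 𝓕 ⇑(f : C₀(E, ℂ)) s • V s ξ) + ∫ s, 𝓕 ⇑(h : C₀(E, ℂ)) s • V s ξ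
    rw [← integral_add (V.integrable_smul (smoothC0.integrable_fourier f) ξ)
      (V.integrable_smul (smoothC0.integrable_fourier h) ξ)]
    refine integral_congr_ae (ae_of_all _ fun s => ?_)
    have h := congrArg (fun k : SchwartzMap E ℂ => k s)
      (FourierTransform.fourier_add (smoothC0.toSchwartz f) (smoothC0.toSchwartz h))
    exact (congrArg (· • V s ξ) h).trans (add_smul _ _ _)
  map_mul' f h := by
    ext ξ
    change ∫ t, 𝓕 ⇑((f : C₀(E, ℂ)) * h) t • V t ξ =
      ∫ s, 𝓕 ⇑(f : C₀(E, ℂ)) s • V s (V.integral (smoothC0.integrable_fourier h) ξ)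
    simp_rw [map_integral, integral_apply, fourier_mul_smoothC0, ← integral_smul_const,
      ← integral_smul, smul_smul]
    -- Multiplicativity is the convolution formula for 𝓕(fh) combined with Fubini; the double
    -- integrand has the norm of the convolution integrand times ‖ξ‖.
    rw [integral_integral_swap]
    · simp_rw [fourier_charMul]
    · have hi := Integrable.convolution_integrand (ContinuousLinearMap.mul ℂ ℂ)
        (smoothC0.integrable_fourier f) (smoothC0.integrable_fourier h)
      refine Integrable.mono' (hi.norm.mul_const ‖ξ‖) (hi.aestronglyMeasurable.smul
        ((V.continuous' ξ).comp continuous_fst).aestronglyMeasurable) ?_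
      filter_upwards with p
      simp [Function.uncurry, norm_smul]
  map_star' f := by
    rw [ContinuousLinearMap.star_eq_adjoint, ContinuousLinearMap.eq_adjoint_iff]
    intro ξ η
    refine V.inner_integral_left _ _ (fun s => ?_) ξ η
    change 𝓕 ⇑(f : C₀(E, ℂ)) s = (starRingEnd ℂ) (𝓕 ⇑(star (f : C₀(E, ℂ))) (-s))
    rw [fourier_star, neg_neg, Complex.conj_conj]

theorem smoothRep_apply (f : smoothC0 E) (ξ : H) :
    V.smoothRep f ξ = ∫ s, 𝓕 ⇑(f : C₀(E, ℂ)) s • V s ξ := rfl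

end UnitaryRep

/-! ### Unitary representations of E versus nondegenerate representations of C₀(E) -/

theorem NonUnitalStarAlgHom.continuous_of_cstar {A B : Type*} [NonUnitalCStarAlgebra A]
    [NonUnitalCStarAlgebra B] (φ : A →⋆ₙₐ[ℂ] B) : Continuous φ :=
  AddMonoidHomClass.continuous_of_bound φ 1 fun a => by
    rw [one_mul]; exact NonUnitalStarAlgHom.norm_apply_le φ a

/-- Isometric extension: a map preserving inner products of a total family extends to a linear
isometry. -/
theorem exists_linearIsometry_of_inner_eq {ι H : Type*} [NormedAddCommGroup H]
    [InnerProductSpace ℂ H] [CompleteSpace H] (x y : ι → H)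
    (hx : (Submodule.span ℂ (Set.range x)).topologicalClosure = ⊤)
    (h : ∀ i j, inner ℂ (y i) (y j) = inner ℂ (x i) (x j)) :
    ∃ T : H →ₗᵢ[ℂ] H, ∀ i, T (x i) = y i := by
  let P := Finsupp.linearCombination ℂ x
  let Q := Finsupp.linearCombination ℂ y
  have hP : DenseRange P := by
    rw [DenseRange, ← LinearMap.coe_range, Finsupp.range_linearCombination]
    exact Submodule.dense_iff_topologicalClosure_eq_top.2 hx
  have hinner : ∀ c, inner ℂ (Q c) (Q c) = inner ℂ (P c) (P c) := fun c => by
    simp only [P, Q, Finsupp.linearCombination_apply, Finsupp.sum, sum_inner, inner_sum,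
      inner_smul_left, inner_smul_right, h]
  have hnorm : ∀ c, ‖Q c‖ = ‖P c‖ := fun c => by
    rw [@norm_eq_sqrt_re_inner ℂ, @norm_eq_sqrt_re_inner ℂ, hinner]
  let T : H →L[ℂ] H := Q.extendOfNorm P
  have hT : ∀ c, T (P c) = Q c :=
    Q.extendOfNorm_eq hP ⟨1, fun c => by rw [one_mul, hnorm]⟩
  refine ⟨⟨T.toLinearMap, fun ξ => ?_⟩, fun i => ?_⟩
  · refine hP.induction_on (p := fun ξ => ‖T ξ‖ = ‖ξ‖) ξ (isClosed_eq (by fun_prop) (by fun_prop))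
      fun c => ?_
    rw [hT, hnorm]
  · have := hT (Finsupp.single i 1)
    simpa [P, Q] using this

/-- Two continuous linear maps agreeing on the vectors `π(a) ξ` of a nondegenerate representation
are equal. -/
theorem ContinuousLinearMap.ext_of_nondegenerate {A H : Type*} [NormedAddCommGroup H]
    [InnerProductSpace ℂ H] {p : A → H →L[ℂ] H}
    (hp : (Submodule.span ℂ {η : H | ∃ a ξ, η = p a ξ}).topologicalClosure = ⊤)
    {S T : H →L[ℂ] H} (h : ∀ a ξ, S (p a ξ) = T (p a ξ)) : S = T := by
  refine ContinuousLinearMap.ext_on (Submodule.dense_iff_topologicalClosure_eq_top.2 hp) ?_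
  rintro _ ⟨a, ξ, rfl⟩
  exact h a ξ

namespace UnitaryRep

variable {E H : Type*} [NormedAddCommGroup E] [InnerProductSpace ℝ E] [NormedAddCommGroup H]
  [InnerProductSpace ℂ H] [CompleteSpace H]

/-- A nondegenerate representation of `C₀(E)` induces a unitary representation of `E` by
multiplication by characters. -/
theorem exists_of_nondegenerate (π : C₀(E, ℂ) →⋆ₙₐ[ℂ] (H →L[ℂ] H))
    (hπ : (Submodule.span ℂ {η : H | ∃ a ξ, η = π a ξ}).topologicalClosure = ⊤) :
    ∃ V : UnitaryRep E H, ∀ s a ξ, V s (π a ξ) = π (charMul s a) ξ := by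
  have hset : {η : H | ∃ a ξ, η = π a ξ} = Set.range fun p : C₀(E, ℂ) × H => π p.1 p.2 := by
    ext η
    simp [eq_comm]
  have hex : ∀ s : E, ∃ T : H →ₗᵢ[ℂ] H, ∀ p : C₀(E, ℂ) × H,
      T (π p.1 p.2) = π (charMul s p.1) p.2 := fun s => by
    refine exists_linearIsometry_of_inner_eq _ _ (hset ▸ hπ) fun p q => ?_
    have key : ∀ a b ξ η, inner ℂ (π a ξ) (π b η) = inner ℂ ξ (π (star a * b) η) := fun a b ξ η => by
      rw [map_mul, map_star, ContinuousLinearMap.star_eq_adjoint, mul_apply_eq_comp,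
        ContinuousLinearMap.adjoint_inner_right]
    simp only [key, star_charMul_mul_charMul]
  choose T hT using hex
  have hT_zero : ∀ ξ, T 0 ξ = ξ := by
    have : (T 0).toContinuousLinearMap = ContinuousLinearMap.id ℂ H := by
      refine ContinuousLinearMap.ext_of_nondegenerate hπ fun a ξ => ?_
      simpa [charMul_zero] using hT 0 (a, ξ)
    exact fun ξ => DFunLike.congr_fun this ξ
  have hT_add : ∀ s t ξ, T (s + t) ξ = T s (T t ξ) := fun s t => by
    have : (T (s + t)).toContinuousLinearMap =
        (T s).toContinuousLinearMap.comp (T t).toContinuousLinearMap := by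
      refine ContinuousLinearMap.ext_of_nondegenerate hπ fun a ξ => ?_
      have h1 := hT (s + t) (a, ξ)
      have h2 := hT s (charMul t a, ξ)
      have h3 := hT t (a, ξ)
      simp only at h1 h2 h3
      simp [h1, h2, h3, charMul_add]
    exact fun ξ => DFunLike.congr_fun this ξ
  -- Continuity holds on the vectors π(a)ξ, since s ↦ `charMul s a` is norm continuous, then on
  -- their span. It passes to the closure because the T s are isometric, so approximation of vectors
  -- is uniform in s.
  have hT_cont : ∀ ξ, Continuous fun s => T s ξ := by
    let M : Submodule ℂ H :=
      { carrier := {ξ | Continuous fun s => T s ξ}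
        add_mem' := fun hξ hη => (Continuous.add hξ hη).congr fun s => ((T s).map_add _ _).symm
        zero_mem' := by simpa using continuous_const
        smul_mem' := fun c ξ hξ => 
          (Continuous.const_smul hξ c).congr fun s => ((T s).map_smul _ _).symm }
    have hM : Submodule.span ℂ {η : H | ∃ a ξ, η = π a ξ} ≤ M := by
      rw [Submodule.span_le]
      rintro _ ⟨a, ξ, rfl⟩
      change Continuous fun s => T s (π a ξ)
      rw [show (fun s => T s (π a ξ)) = fun s => π (charMul s a) ξ from
        funext fun s => hT s (a, ξ)]
      exact (ContinuousLinearMap.apply ℂ H ξ).continuous.comp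
        ((NonUnitalStarAlgHom.continuous_of_cstar π).comp (continuous_charMul_left a))
    intro ξ
    refine continuous_of_uniform_approx_of_continuous fun u hu => ?_
    obtain ⟨ε, hε, hu⟩ := Metric.mem_uniformity_dist.1 hu
    have hξ : ξ ∈ (Submodule.span ℂ {η : H | ∃ a ξ, η = π a ξ}).topologicalClosure := by
      rw [hπ]; trivial
    obtain ⟨η, hη, hd⟩ := Metric.mem_closure_iff.1 hξ ε hε
    exact ⟨fun s => T s η, hM hη, fun s => hu (by rwa [(T s).dist_map])⟩
  refine ⟨⟨fun s => ⟨⟨(T s).toLinearMap, T (-s), fun ξ => ?_, fun ξ => ?_⟩, (T s).norm_map⟩,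
    hT_zero, hT_add, hT_cont⟩, fun s a ξ => hT s (a, ξ)⟩
  · change T (-s) (T s ξ) = ξ
    rw [← hT_add, neg_add_cancel, hT_zero]
  · change T s (T (-s) ξ) = ξ
    rw [← hT_add, add_neg_cancel, hT_zero]

variable [FiniteDimensional ℝ E] [MeasurableSpace E] [BorelSpace E] (V : UnitaryRep E H)

/-- On a vector π(a)ξ the integral moves inside π, where `integral_smul_charMul` computes it as 𝓕⁻ g
· a. -/
theorem integral_eq_of_nondegenerate (π : C₀(E, ℂ) →⋆ₙₐ[ℂ] (H →L[ℂ] H))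
    (hπ : (Submodule.span ℂ {η : H | ∃ a ξ, η = π a ξ}).topologicalClosure = ⊤)
    (hV : ∀ s a ξ, V s (π a ξ) = π (charMul s a) ξ) {g : E → ℂ} (hg : Integrable g) :
    V.integral hg = π (fourierInvC0 g) := by
  refine ContinuousLinearMap.ext_of_nondegenerate hπ fun a ξ => ?_
  let L : C₀(E, ℂ) →L[ℂ] H :=
    LinearMap.mkContinuous
      { toFun := fun a => π a ξ
        map_add' := fun a b => by rw [map_add]; rfl
        map_smul' := fun c a => by rw [map_smul]; rfl } ‖ξ‖ fun a => by
      rw [mul_comm]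
      exact (π a).le_of_opNorm_le (NonUnitalStarAlgHom.norm_apply_le π a) ξ
  have h1 : π (fourierInvC0 g) (π a ξ) = L (fourierInvC0 g * a) := by
    change _ = π (fourierInvC0 g * a) ξ
    rw [map_mul]; rfl
  rw [h1, ← integral_smul_charMul hg, ← L.integral_comp_comm (integrable_smul_charMul hg a),
    integral_apply]
  refine integral_congr_ae (ae_of_all _ fun s => ?_)
  simp only [hV, map_smul]
  rfl

/-- Dilated bumps F k(y) = χ(y/(k+1)) form an approximate unit. With φ = 𝓕χ, substitution gives
V(𝓕(F k))ξ = ∫ φ(u) V(u/(k+1))ξ du, which tends to (∫ φ)ξ = χ(0)ξ = ξ by dominated convergence. -/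
theorem mem_closure_span_smoothRep (ξ : H) : ξ ∈
    (Submodule.span ℂ {η : H | ∃ f ξ, η = V.smoothRep f ξ}).topologicalClosure := by
  let χ : ContDiffBump (0 : E) := ⟨1, 2, one_pos, one_lt_two⟩
  have hχ : ContDiff ℝ ∞ fun y => (χ y : ℂ) := Complex.ofRealCLM.contDiff.comp χ.contDiff
  have hχc : HasCompactSupport fun y => (χ y : ℂ) :=
    χ.hasCompactSupport.comp_left (g := fun r : ℝ => (r : ℂ)) Complex.ofReal_zero
  let f : smoothC0 E := smoothC0.mk _ hχ hχc
  let φ : E → ℂ := 𝓕 ⇑(f : C₀(E, ℂ))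
  have hφ : Integrable φ := smoothC0.integrable_fourier f
  let c : ℕ → ℝ := fun k => 1 / ((k : ℝ) + 1)
  have hc : ∀ k, 0 < c k := fun k => by positivity
  let F : ℕ → smoothC0 E := fun k =>
    smoothC0.mk (fun y => (χ (c k • y) : ℂ)) (hχ.comp (contDiff_const_smul (c k)))
      (hχc.comp_homeomorph (Homeomorph.smulOfNeZero (c k) (hc k).ne'))
  have hF : ∀ k s, 𝓕 ⇑(F k : C₀(E, ℂ)) s =
      |(c k ^ Module.finrank ℝ E)⁻¹| • φ ((c k)⁻¹ • s) := fun k s => by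
    simp only [φ, Real.fourier_eq]
    rw [← Measure.integral_comp_smul]
    refine integral_congr_ae (ae_of_all _ fun y => ?_)
    simp only [inner_smul_left, inner_smul_right, RCLike.conj_to_real,
      inv_mul_cancel_left₀ (hc k).ne']
    rfl
  have hVF : ∀ k, V.smoothRep (F k) ξ = ∫ u, φ u • V (c k • u) ξ := fun k => by
    rw [smoothRep_apply]
    have h := Measure.integral_comp_smul volume (fun u => φ u • V (c k • u) ξ) (c k)⁻¹
    simp only [smul_inv_smul₀ (hc k).ne'] at h
    simp only [hF, smul_assoc]
    rw [integral_smul, h, smul_smul, ← abs_mul, inv_pow, inv_inv, inv_mul_cancel₀, abs_one,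
      one_smul]
    exact (pow_pos (hc k) _).ne'
  have hint : ∫ u, φ u = 1 := by
    have h := congrArg (fun a : C₀(E, ℂ) => a 0) (smoothC0.fourierInvC0_fourier f)
    simp only [fourierInvC0_apply, Real.fourierInv_eq, inner_zero_right, AddChar.map_zero_eq_one,
      one_smul] at h
    rw [h]
    change ((χ 0 : ℝ) : ℂ) = 1
    rw [χ.one_of_mem_closedBall (by simp [χ])]
    simp
  have hlim : Tendsto (fun k => V.smoothRep (F k) ξ) atTop (𝓝 ξ) := by
    simp_rw [hVF]
    have h1 : ξ = ∫ u, φ u • ξ := by rw [integral_smul_const, hint, one_smul]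
    nth_rewrite 2 [h1]
    refine tendsto_integral_of_dominated_convergence (fun u => ‖φ u‖ * ‖ξ‖) (fun k => ?_)
      (hφ.norm.mul_const _) (fun k => ae_of_all _ fun u => ?_) (ae_of_all _ fun u => ?_)
    · exact hφ.aestronglyMeasurable.smul
        ((V.continuous' ξ).comp
          (continuous_const_smul (c k) : Continuous fun u : E => c k • u)).aestronglyMeasurable
    · rw [norm_smul, LinearIsometryEquiv.norm_map]
    · refine Tendsto.const_smul ?_ _
      have h2 : Tendsto (fun k => c k • u) atTop (𝓝 0) := by
        have := (tendsto_one_div_add_atTop_nhds_zero_nat (𝕜 := ℝ)).smul_const u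
        rwa [zero_smul] at this
      have h3 := ((V.continuous' ξ).tendsto 0).comp h2
      rwa [V.map_zero'] at h3
  exact mem_closure_of_tendsto hlim (Eventually.of_forall fun k =>
    Submodule.subset_span ⟨F k, ξ, rfl⟩)

/-- The spectral theorem for unitary representations of `E`: they come from representations of
`C₀(E)`. -/
theorem exists_nondegenerate : ∃ π : C₀(E, ℂ) →⋆ₙₐ[ℂ] (H →L[ℂ] H),
    (Submodule.span ℂ {η : H | ∃ a ξ, η = π a ξ}).topologicalClosure = ⊤ ∧
    ∀ s a ξ, V s (π a ξ) = π (charMul s a) ξ := by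
  obtain ⟨π, hπ⟩ := exists_extension_smoothC0 V.smoothRep
  refine ⟨π, ?_, fun s a ξ => ?_⟩
  · refine eq_top_iff.2 fun ξ _ => Submodule.topologicalClosure_mono (Submodule.span_mono ?_)
      (V.mem_closure_span_smoothRep ξ)
    rintro _ ⟨f, ξ, rfl⟩
    exact ⟨f, ξ, by rw [hπ]⟩
  · have hπc : Continuous π := NonUnitalStarAlgHom.continuous_of_cstar π
    refine dense_smoothC0.induction (P := fun a => V s (π a ξ) = π (charMul s a) ξ)
      (fun a ha => ?_) (isClosed_eq ?_ ?_) a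
    · have h1 := hπ ⟨a, ha⟩
      have h2 := hπ ⟨charMul s a, charMul_mem_smoothC0 s ha⟩
      simp only at h1 h2
      rw [h1, h2]
      exact V.map_integral s ⟨a, ha⟩ ξ
    · exact (V s).continuous.comp ((ContinuousLinearMap.apply ℂ H ξ).continuous.comp hπc)
    · exact (ContinuousLinearMap.apply ℂ H ξ).continuous.comp
        (hπc.comp (isometry_charMul s).continuous)

end UnitaryRep

/-! ### The phase relating the two actions -/

theorem latticeInclusion_apply (q : Fin d → ℤ) (i : Fin d) : latticeInclusion d q i = q i := rfl

/-- The phase `exp (2πi ⟪s, Λᵀ q⟫)` relating the actions of `ℝⁿ` and `ℤᵈ`. -/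
def latticePhase (Λ : Matrix (Fin d) (Fin n) ℝ) (s : EuclideanSpace ℝ (Fin n)) (q : Fin d → ℤ) :
    ℂ :=
  (𝐞 (inner ℝ s (Matrix.toEuclideanLin Λᵀ (latticeInclusion d q))) : ℂ)

variable (Λ : Matrix (Fin d) (Fin n) ℝ)

theorem latticePhase_neg_mul (s : EuclideanSpace ℝ (Fin n)) (q : Fin d → ℤ) :
    latticePhase Λ (-s) q * latticePhase Λ s q = 1 := by
  rw [latticePhase, latticePhase, ← Circle.coe_mul, ← AddChar.map_add_eq_mul, inner_neg_left,
    neg_add_cancel, AddChar.map_zero_eq_one, Circle.coe_one]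

theorem norm_latticePhase (s : EuclideanSpace ℝ (Fin n)) (q : Fin d → ℤ) :
    ‖latticePhase Λ s q‖ = 1 := Circle.norm_coe _

theorem continuous_latticePhase (q : Fin d → ℤ) : Continuous fun s => latticePhase Λ s q :=
  continuous_subtype_val.comp (Real.continuous_fourierChar.comp (by fun_prop))

theorem affineSystem_act_apply (q : Fin d → ℤ) (a : C₀(EuclideanSpace ℝ (Fin n), ℂ))
    (y : EuclideanSpace ℝ (Fin n)) :
    (affineSystem Λ).act q a y = a (y - Matrix.toEuclideanLin Λᵀ (latticeInclusion d q)) := by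
  change a (y + Matrix.toEuclideanLin Λᵀ (-latticeInclusion d q)) = _
  rw [map_neg, sub_eq_add_neg]

/-- Translating the character at s by Λᵀq only changes it by a constant of modulus one; this
constant is the phase in the commutation relation. -/
theorem charMul_affineSystem_act (s : EuclideanSpace ℝ (Fin n)) (q : Fin d → ℤ)
    (a : C₀(EuclideanSpace ℝ (Fin n), ℂ)) :
    charMul s ((affineSystem Λ).act q a) =
      latticePhase Λ s q • (affineSystem Λ).act q (charMul s a) := by
  ext y
  simp only [charMul_apply, ZeroAtInftyContinuousMap.smul_apply, affineSystem_act_apply,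
    smul_eq_mul, latticePhase]
  rw [← mul_assoc, ← Circle.coe_mul, ← AddChar.map_add_eq_mul, ← inner_add_right,
    add_sub_cancel]

theorem dualSystem_act_mFourier (s : EuclideanSpace ℝ (Fin n)) (q : Fin d → ℤ) :
    (dualSystem Λ).act s (UnitAddTorus.mFourier q) =
      latticePhase Λ s q • UnitAddTorus.mFourier q := by
  ext k
  change UnitAddTorus.mFourier q (k - toTorus (Matrix.toEuclideanLin Λ (-s))) =
    latticePhase Λ s q * UnitAddTorus.mFourier q k
  -- The adjunction ⟨s, Λᵀq⟩ = ⟨Λs, q⟩ is where the two actions are seen to be dual.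
  have hinner : inner ℝ s (Matrix.toEuclideanLin Λᵀ (latticeInclusion d q)) =
      ∑ i, (q i : ℝ) * Matrix.toEuclideanLin Λ s i := by
    simp only [PiLp.inner_apply, Matrix.toLpLin_apply, Matrix.mulVec, dotProduct,
      Matrix.transpose_apply, latticeInclusion_apply, Finset.mul_sum, RCLike.inner_apply,
      RCLike.conj_to_real, Finset.sum_mul]
    rw [Finset.sum_comm]
    refine Finset.sum_congr rfl fun i _ => Finset.sum_congr rfl fun j _ => ?_
    ring
  have htorus : ∀ x : EuclideanSpace ℝ (Fin d),
      UnitAddTorus.mFourier q (toTorus x) = (𝐞 (∑ i, (q i : ℝ) * x i) : ℂ) := fun x => by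
    change ∏ i, fourier (q i) ((x i : ℝ) : UnitAddCircle) = _
    rw [Real.fourierChar_apply, Finset.mul_sum, Complex.ofReal_sum, Finset.sum_mul,
      Complex.exp_sum]
    refine Finset.prod_congr rfl fun i _ => ?_
    rw [fourier_coe_apply]
    congr 1
    push_cast
    ring
  rw [latticePhase, hinner, ← htorus]
  change ∏ i, fourier (q i) (k i - (Matrix.toEuclideanLin Λ (-s) i : UnitAddCircle)) =
    (∏ i, fourier (q i) (Matrix.toEuclideanLin Λ s i : UnitAddCircle)) * ∏ i, fourier (q i) (k i)
  rw [← Finset.prod_mul_distrib]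
  refine Finset.prod_congr rfl fun i _ => ?_
  rw [map_neg, PiLp.neg_apply, AddCircle.coe_neg, sub_neg_eq_add, add_comm]
  simp only [fourier_apply, smul_add, AddCircle.toCircle_add, Circle.coe_mul]

theorem affineSystem_act_fourierInvC0 (q : Fin d → ℤ) (g : EuclideanSpace ℝ (Fin n) → ℂ) :
    (affineSystem Λ).act q (fourierInvC0 g) =
      fourierInvC0 fun s => latticePhase Λ (-s) q * g s := by
  ext y
  rw [affineSystem_act_apply, fourierInvC0_apply, fourierInvC0_apply, Real.fourierInv_eq,
    Real.fourierInv_eq]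
  refine integral_congr_ae (ae_of_all _ fun s => ?_)
  simp only [latticePhase, Circle.smul_def, smul_eq_mul]
  rw [← mul_assoc, ← Circle.coe_mul, ← AddChar.map_add_eq_mul, inner_neg_left, inner_sub_right,
    sub_eq_add_neg]

/-- A continuous linear map sending the monomials into a closed subspace sends all of `C(𝕋ᵈ)`
into it. -/
theorem mem_of_mFourier_mem {ι M : Type*} [Fintype ι] [TopologicalSpace M] [AddCommGroup M]
    [Module ℂ M] (K : Submodule ℂ M) (hK : IsClosed (K : Set M))
    (L : C(UnitAddTorus ι, ℂ) →L[ℂ] M) (h : ∀ q, L (UnitAddTorus.mFourier q) ∈ K)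
    (f : C(UnitAddTorus ι, ℂ)) : L f ∈ K := by
  have h1 : (Submodule.span ℂ (Set.range (UnitAddTorus.mFourier (d := ι)))).topologicalClosure ≤
      K.comap L.toLinearMap := by
    refine Submodule.topologicalClosure_minimal _ ?_ (hK.preimage L.continuous)
    rw [Submodule.span_le]
    rintro _ ⟨q, rfl⟩
    exact h q
  rw [UnitAddTorus.span_mFourier_closure_eq_top] at h1
  exact h1 trivial

theorem ext_mFourier {ι M : Type*} [Fintype ι] [TopologicalSpace M] [T2Space M] [AddCommGroup M]
    [Module ℂ M] {L L' : C(UnitAddTorus ι, ℂ) →L[ℂ] M}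
    (h : ∀ q, L (UnitAddTorus.mFourier q) = L' (UnitAddTorus.mFourier q)) : L = L' := by
  refine ContinuousLinearMap.ext_on (Submodule.dense_iff_topologicalClosure_eq_top.2
    (UnitAddTorus.span_mFourier_closure_eq_top (d := ι))) ?_
  rintro _ ⟨q, rfl⟩
  exact h q

/-- A *-homomorphism between C*-algebras as a continuous linear map. -/
def NonUnitalStarAlgHom.toCLM {A B : Type*} [NonUnitalCStarAlgebra A]
    [NonUnitalCStarAlgebra B] (φ : A →⋆ₙₐ[ℂ] B) : A →L[ℂ] B :=
  ⟨{ toFun := φ, map_add' := map_add φ, map_smul' := map_smul φ }, φ.continuous_of_cstar⟩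

namespace CovariantRep

variable {Λ}

/-! ### From representations of the affine system to representations of the dual system -/

section toDual

variable (ρ : CovariantRep (affineSystem Λ))

/-- The unitary representation of `ℝⁿ` by characters of the spectrum. -/
def charRep : UnitaryRep (EuclideanSpace ℝ (Fin n)) ρ.H :=
  (UnitaryRep.exists_of_nondegenerate ρ.π ρ.nondegenerate).choose

theorem charRep_apply (s : EuclideanSpace ℝ (Fin n)) (a : C₀(EuclideanSpace ℝ (Fin n), ℂ))
    (ξ : ρ.H) : ρ.charRep s (ρ.π a ξ) = ρ.π (charMul s a) ξ :=
  (UnitaryRep.exists_of_nondegenerate ρ.π ρ.nondegenerate).choose_spec s a ξ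

theorem exists_torusRep : ∃ σ : C(UnitAddTorus (Fin d), ℂ) →⋆ₐ[ℂ] (ρ.H →L[ℂ] ρ.H),
    ∀ q, σ (UnitAddTorus.mFourier q) = (ρ.U q).toLinearIsometry.toContinuousLinearMap := by
  refine exists_starAlgHom_mFourier _ ?_ (fun p q => ?_) (fun q => ?_)
  · ext ξ; exact ρ.U_zero ξ
  · ext ξ; exact ρ.U_add p q ξ
  · rw [ContinuousLinearMap.star_eq_adjoint, eq_comm, ContinuousLinearMap.eq_adjoint_iff]
    intro ξ η
    change inner ℂ (ρ.U (-q) ξ) η = inner ℂ ξ (ρ.U q η)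
    rw [← (ρ.U q).inner_map_map, ← ρ.U_add, add_neg_cancel, ρ.U_zero]

/-- The representation of `C(𝕋ᵈ)` with Fourier coefficients `U_q`. -/
def torusRep : C(UnitAddTorus (Fin d), ℂ) →⋆ₐ[ℂ] (ρ.H →L[ℂ] ρ.H) := ρ.exists_torusRep.choose

theorem torusRep_mFourier (q : Fin d → ℤ) (ξ : ρ.H) :
    ρ.torusRep (UnitAddTorus.mFourier q) ξ = ρ.U q ξ := by
  rw [torusRep, ρ.exists_torusRep.choose_spec]; rfl

/-- The commutation relation between V and U. On vectors π(a)η it follows from covariance and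
`charMul_affineSystem_act`; nondegeneracy does the rest. -/
theorem charRep_U (s : EuclideanSpace ℝ (Fin n)) (q : Fin d → ℤ) (ξ : ρ.H) :
    ρ.charRep s (ρ.U q ξ) = latticePhase Λ s q • ρ.U q (ρ.charRep s ξ) := by
  let T (s) : ρ.H →L[ℂ] ρ.H := (ρ.charRep s).toLinearIsometry.toContinuousLinearMap
  let W : ρ.H →L[ℂ] ρ.H := (ρ.U q).toLinearIsometry.toContinuousLinearMap
  suffices (T s).comp W = latticePhase Λ s q • W.comp (T s) from DFunLike.congr_fun this ξ
  refine ContinuousLinearMap.ext_of_nondegenerate ρ.nondegenerate fun a η => ?_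
  change ρ.charRep s (ρ.U q (ρ.π a η)) = latticePhase Λ s q • ρ.U q (ρ.charRep s (ρ.π a η))
  rw [ρ.covariant, charRep_apply, charRep_apply, ρ.covariant, charMul_affineSystem_act, map_smul]
  rfl

/-- The covariant representation of the dual system attached to one of the affine system. -/
@[reducible] def toDual : CovariantRep (dualSystem Λ) where
  H := ρ.H
  π := (ρ.torusRep : C(UnitAddTorus (Fin d), ℂ) →⋆ₙₐ[ℂ] (ρ.H →L[ℂ] ρ.H))
  nondegenerate := by
    refine eq_top_iff.2 fun ξ _ => Submodule.le_topologicalClosure _ (Submodule.subset_span ?_)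
    exact ⟨1, ξ, by simp⟩
  U s := ρ.charRep s
  U_zero := ρ.charRep.map_zero'
  U_add := ρ.charRep.map_add'
  continuous_U := ρ.charRep.continuous'
  covariant s f ξ := by
    let T : ρ.H →L[ℂ] ρ.H := (ρ.charRep s).toLinearIsometry.toContinuousLinearMap
    let σ : C(UnitAddTorus (Fin d), ℂ) →⋆ₙₐ[ℂ] (ρ.H →L[ℂ] ρ.H) := ρ.torusRep
    let α : C(UnitAddTorus (Fin d), ℂ) →⋆ₙₐ[ℂ] C(UnitAddTorus (Fin d), ℂ) :=
      (dualSystem Λ).act s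
    suffices T.comp ((ContinuousLinearMap.apply ℂ ρ.H ξ).comp σ.toCLM) =
        (ContinuousLinearMap.apply ℂ ρ.H (T ξ)).comp (σ.toCLM.comp α.toCLM) from
      DFunLike.congr_fun this f
    -- Both sides are continuous and linear in f, and on monomials covariance is the commutation
    -- relation `charRep_U`.
    refine ext_mFourier fun q => ?_
    change ρ.charRep s (ρ.torusRep (UnitAddTorus.mFourier q) ξ) =
      ρ.torusRep ((dualSystem Λ).act s (UnitAddTorus.mFourier q)) (ρ.charRep s ξ)
    rw [dualSystem_act_mFourier, map_smul, torusRep_mFourier, charRep_U,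
      ← torusRep_mFourier]
    rfl

end toDual

/-! ### From representations of the dual system to representations of the affine system -/

section ofDual

variable (ρ : CovariantRep (dualSystem Λ))

/-- The unitary representation of `ℝⁿ` underlying a covariant representation. -/
def unitaryRep : UnitaryRep (EuclideanSpace ℝ (Fin n)) ρ.H :=
  ⟨ρ.U, ρ.U_zero, ρ.U_add, ρ.continuous_U⟩

/-- The representation of `C₀(ℝⁿ)` given by the spectral theorem. -/
def spectralRep : C₀(EuclideanSpace ℝ (Fin n), ℂ) →⋆ₙₐ[ℂ] (ρ.H →L[ℂ] ρ.H) :=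
  ρ.unitaryRep.exists_nondegenerate.choose

theorem spectralRep_nondegenerate :
    (Submodule.span ℂ {η : ρ.H | ∃ a ξ, η = ρ.spectralRep a ξ}).topologicalClosure = ⊤ :=
  ρ.unitaryRep.exists_nondegenerate.choose_spec.1

theorem U_spectralRep (s : EuclideanSpace ℝ (Fin n)) (a : C₀(EuclideanSpace ℝ (Fin n), ℂ))
    (ξ : ρ.H) : ρ.U s (ρ.spectralRep a ξ) = ρ.spectralRep (charMul s a) ξ :=
  ρ.unitaryRep.exists_nondegenerate.choose_spec.2 s a ξ

theorem spectralRep_fourierInvC0 {g : EuclideanSpace ℝ (Fin n) → ℂ} (hg : Integrable g) :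
    ρ.spectralRep (fourierInvC0 g) = ρ.unitaryRep.integral hg :=
  (ρ.unitaryRep.integral_eq_of_nondegenerate _ ρ.spectralRep_nondegenerate ρ.U_spectralRep
    hg).symm

theorem π_one : ρ.π 1 = 1 := by
  refine ContinuousLinearMap.ext_of_nondegenerate ρ.nondegenerate fun f ξ => ?_
  rw [← mul_apply_eq_comp, ← map_mul, one_mul]
  rfl

theorem π_mFourier_add (p q : Fin d → ℤ) : ρ.π (UnitAddTorus.mFourier (p + q)) =
    ρ.π (UnitAddTorus.mFourier p) * ρ.π (UnitAddTorus.mFourier q) := by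
  rw [← map_mul]
  congr 1
  ext x
  exact UnitAddTorus.mFourier_add

theorem star_π_mFourier (q : Fin d → ℤ) : star (ρ.π (UnitAddTorus.mFourier q)) =
    ρ.π (UnitAddTorus.mFourier (-q)) := by
  rw [← map_star]
  congr 1
  ext x
  exact UnitAddTorus.mFourier_neg.symm

theorem π_mFourier_zero : ρ.π (UnitAddTorus.mFourier 0) = 1 := by
  rw [UnitAddTorus.mFourier_zero, π_one]

/-- The unitary `σ(e_q)` attached to a monomial on the torus. -/
def latticeUnitary (q : Fin d → ℤ) : ρ.H ≃ₗᵢ[ℂ] ρ.H :=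
  Unitary.linearIsometryEquiv ⟨ρ.π (UnitAddTorus.mFourier q), by
    rw [Unitary.mem_iff, star_π_mFourier, ← π_mFourier_add, ← π_mFourier_add, neg_add_cancel,
      add_neg_cancel, π_mFourier_zero]
    exact ⟨rfl, rfl⟩⟩

theorem latticeUnitary_apply (q : Fin d → ℤ) (ξ : ρ.H) :
    ρ.latticeUnitary q ξ = ρ.π (UnitAddTorus.mFourier q) ξ := rfl

theorem U_π_mFourier (s : EuclideanSpace ℝ (Fin n)) (q : Fin d → ℤ) (ξ : ρ.H) :
    ρ.U s (ρ.π (UnitAddTorus.mFourier q) ξ) =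
      latticePhase Λ s q • ρ.π (UnitAddTorus.mFourier q) (ρ.U s ξ) := by
  rw [ρ.covariant, dualSystem_act_mFourier, map_smul]
  rfl

/-- The integrated commutation relation: moving the monomial across V(g) multiplies g by the phase.
-/
theorem π_mFourier_integral (q : Fin d → ℤ) {g : EuclideanSpace ℝ (Fin n) → ℂ}
    (hg : Integrable g) (hg' : Integrable fun s => latticePhase Λ s q * g s) (ξ : ρ.H) :
    ρ.unitaryRep.integral hg (ρ.π (UnitAddTorus.mFourier q) ξ) =
      ρ.π (UnitAddTorus.mFourier q) (ρ.unitaryRep.integral hg' ξ) := by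
  rw [UnitaryRep.integral_apply, UnitaryRep.integral_apply,
    ← ContinuousLinearMap.integral_comp_comm _ (ρ.unitaryRep.integrable_smul hg' ξ)]
  refine integral_congr_ae (ae_of_all _ fun s => ?_)
  change g s • ρ.U s (ρ.π (UnitAddTorus.mFourier q) ξ) =
    ρ.π (UnitAddTorus.mFourier q) ((latticePhase Λ s q * g s) • ρ.U s ξ)
  rw [U_π_mFourier, map_smul, smul_smul, mul_comm]

/-- By density a = 𝓕⁻ g, with image V(g). The action of q multiplies g by the inverse phase, and
moving the unitary across the integral restores it. -/
theorem latticeUnitary_spectralRep (q : Fin d → ℤ) (a : C₀(EuclideanSpace ℝ (Fin n), ℂ))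
    (ξ : ρ.H) : ρ.latticeUnitary q (ρ.spectralRep a ξ) =
      ρ.spectralRep ((affineSystem Λ).act q a) (ρ.latticeUnitary q ξ) := by
  let α : C₀(EuclideanSpace ℝ (Fin n), ℂ) →⋆ₙₐ[ℂ] C₀(EuclideanSpace ℝ (Fin n), ℂ) :=
    (affineSystem Λ).act q
  have hα : Continuous ((affineSystem Λ).act q) := α.continuous_of_cstar
  have hc : ∀ ξ, Continuous fun a => ρ.spectralRep a ξ := fun ξ =>
    (ContinuousLinearMap.apply ℂ ρ.H ξ).continuous.comp ρ.spectralRep.continuous_of_cstar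
  refine dense_range_fourierInvC0.induction_on (p := fun a => ρ.latticeUnitary q
    (ρ.spectralRep a ξ) = ρ.spectralRep ((affineSystem Λ).act q a) (ρ.latticeUnitary q ξ)) a
    (isClosed_eq ((ρ.latticeUnitary q).continuous.comp (hc ξ)) ((hc _).comp hα)) fun g => ?_
  have hg : Integrable ⇑g := g.continuous.integrable_of_hasCompactSupport g.hasCompactSupport
  have hg' : Integrable fun s => latticePhase Λ (-s) q * g s := by
    refine Integrable.mono' hg.norm (((continuous_latticePhase Λ q).comp
      continuous_neg).aestronglyMeasurable.mul hg.aestronglyMeasurable) ?_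
    filter_upwards with s
    rw [norm_mul, norm_latticePhase, one_mul]
  rw [affineSystem_act_fourierInvC0, spectralRep_fourierInvC0 ρ hg, spectralRep_fourierInvC0 ρ hg',
    latticeUnitary_apply, latticeUnitary_apply]
  have h : (fun s => latticePhase Λ s q * (latticePhase Λ (-s) q * g s)) = ⇑g := by
    ext s
    rw [← mul_assoc, mul_comm (latticePhase Λ s q), latticePhase_neg_mul, one_mul]
  rw [π_mFourier_integral ρ q hg' (by rwa [h])]
  simp only [h]

/-- The covariant representation of the affine system attached to one of the dual system. -/
@[reducible] def ofDual : CovariantRep (affineSystem Λ) where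
  H := ρ.H
  π := ρ.spectralRep
  nondegenerate := ρ.spectralRep_nondegenerate
  U := ρ.latticeUnitary
  U_zero ξ := by rw [latticeUnitary_apply, π_mFourier_zero]; rfl
  U_add p q ξ := by
    rw [latticeUnitary_apply, π_mFourier_add]; rfl
  continuous_U _ := continuous_of_discreteTopology
  covariant := ρ.latticeUnitary_spectralRep

end ofDual

end CovariantRep

/-! ### Isomorphisms of closed *-algebras given by generators -/

namespace NonUnitalStarAlgebra

variable {A B : Type*} [NonUnitalCStarAlgebra A] [NonUnitalCStarAlgebra B]

theorem map_mem_topologicalClosure_adjoin {s : Set A} {t : Set B} (φ : A →⋆ₙₐ[ℂ] B)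
    (h : ∀ a ∈ s, φ a ∈ (adjoin ℂ t).topologicalClosure) {a : A}
    (ha : a ∈ (adjoin ℂ s).topologicalClosure) : φ a ∈ (adjoin ℂ t).topologicalClosure := by
  have hle : (adjoin ℂ s).topologicalClosure ≤ (adjoin ℂ t).topologicalClosure.comap φ :=
    NonUnitalStarSubalgebra.topologicalClosure_minimal _ (adjoin_le h)
      ((NonUnitalStarSubalgebra.isClosed_topologicalClosure _).preimage φ.continuous_of_cstar)
  exact hle ha

theorem map_eq_self_of_mem_topologicalClosure_adjoin {s : Set A} (φ : A →⋆ₙₐ[ℂ] A)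
    (h : ∀ a ∈ s, φ a = a) {a : A} (ha : a ∈ (adjoin ℂ s).topologicalClosure) : φ a = a := by
  have hle : (adjoin ℂ s).topologicalClosure ≤
      NonUnitalStarAlgHom.equalizer φ (NonUnitalStarAlgHom.id ℂ A) :=
    NonUnitalStarSubalgebra.topologicalClosure_minimal _ (adjoin_le h)
      (isClosed_eq φ.continuous_of_cstar continuous_id)
  exact hle ha

/-- Two closed *-subalgebras, given by generators, are isomorphic as soon as there are
*-homomorphisms between the ambient algebras that are mutually inverse on the generators. -/
theorem nonempty_equiv_topologicalClosure_adjoin (s : Set A) (t : Set B)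
    (φ : A →⋆ₙₐ[ℂ] B) (ψ : B →⋆ₙₐ[ℂ] A)
    (hφ : ∀ a ∈ s, φ a ∈ (adjoin ℂ t).topologicalClosure)
    (hψ : ∀ b ∈ t, ψ b ∈ (adjoin ℂ s).topologicalClosure)
    (hψφ : ∀ a ∈ s, ψ (φ a) = a) (hφψ : ∀ b ∈ t, φ (ψ b) = b) :
    Nonempty ((adjoin ℂ s).topologicalClosure ≃⋆ₐ[ℂ] (adjoin ℂ t).topologicalClosure) :=
  ⟨{ toFun := fun a => ⟨φ a, map_mem_topologicalClosure_adjoin φ hφ a.2⟩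
     invFun := fun b => ⟨ψ b, map_mem_topologicalClosure_adjoin ψ hψ b.2⟩
     left_inv := fun a => Subtype.ext
       (map_eq_self_of_mem_topologicalClosure_adjoin (ψ.comp φ) hψφ a.2)
     right_inv := fun b => Subtype.ext
       (map_eq_self_of_mem_topologicalClosure_adjoin (φ.comp ψ) hφψ b.2)
     map_mul' := fun _ _ => Subtype.ext (map_mul φ _ _)
     map_add' := fun _ _ => Subtype.ext (map_add φ _ _)
     map_star' := fun _ => Subtype.ext (map_star φ _)
     map_smul' := fun c _ => Subtype.ext (map_smul φ c _) }⟩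

end NonUnitalStarAlgebra

/-! ### Pulling back families of operators and comparing generators -/

/-- Reindexing of bounded families along a map of index types. -/
def lpReindex {ι κ : Type*} (f : ι → κ) (A : κ → Type*) [∀ k, NonUnitalCStarAlgebra (A k)] :
    lp A ∞ →⋆ₙₐ[ℂ] lp (fun i => A (f i)) ∞ where
  toFun T := ⟨fun i => T (f i), memℓp_infty (by
    obtain ⟨C, hC⟩ := (memℓp_infty_iff.1 T.2)
    refine ⟨C, ?_⟩
    rintro _ ⟨i, rfl⟩
    exact hC ⟨f i, rfl⟩)⟩
  map_smul' _ _ := rfl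
  map_zero' := rfl
  map_add' _ _ := rfl
  map_mul' _ _ := rfl
  map_star' _ := rfl

variable (Λ : Matrix (Fin d) (Fin n) ℝ)

/-- Pull-back of families of operators along `ρ ↦ ρ.toDual`. -/
def pullToDual : UniversalAlgebra (dualSystem Λ) →⋆ₙₐ[ℂ] UniversalAlgebra (affineSystem Λ) :=
  lpReindex (fun ρ : CovariantRep (affineSystem Λ) => ρ.toDual)
    (fun ρ : CovariantRep (dualSystem Λ) => ρ.H →L[ℂ] ρ.H)

/-- Pull-back of families of operators along `ρ ↦ ρ.ofDual`. -/
def pullOfDual : UniversalAlgebra (affineSystem Λ) →⋆ₙₐ[ℂ] UniversalAlgebra (dualSystem Λ) :=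
  lpReindex (fun ρ : CovariantRep (dualSystem Λ) => ρ.ofDual)
    (fun ρ : CovariantRep (affineSystem Λ) => ρ.H →L[ℂ] ρ.H)

section crossedElement

variable {G : Type u} {A : Type v} [AddCommGroup G] [TopologicalSpace G]
  [NonUnitalCStarAlgebra A] [MeasurableSpace G] [BorelSpace G]

theorem crossedElement_apply (S : CStarSystem G A) (μ : Measure G) [IsFiniteMeasureOnCompacts μ]
    (a : A) (g : C_c(G, ℂ)) (ρ : CovariantRep S) :
    crossedElement S μ a g ρ = ρ.π a * ρ.integrated μ g := rfl

/-- The map `a ↦ a ⊗ g`, as a continuous linear map. -/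
def crossedElementCLM (S : CStarSystem G A) (μ : Measure G) [IsFiniteMeasureOnCompacts μ]
    (g : C_c(G, ℂ)) : A →L[ℂ] UniversalAlgebra S :=
  LinearMap.mkContinuous
    { toFun := fun a => crossedElement S μ a g
      map_add' := fun a b => by
        ext ρ : 2
        simp [crossedElement_apply, add_mul]
      map_smul' := fun c a => by
        ext ρ : 2
        simp [crossedElement_apply] }
    (∫ s, ‖g s‖ ∂μ) fun a => by
      refine lp.norm_le_of_forall_le (by positivity) fun ρ => ?_
      refine (norm_mul_le _ _).trans ?_
      rw [mul_comm]
      exact mul_le_mul (ρ.norm_integrated_le μ g) (NonUnitalStarAlgHom.norm_apply_le ρ.π a)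
        (norm_nonneg _) (by positivity)

theorem crossedElement_mem (S : CStarSystem G A) (μ : Measure G) [μ.IsAddHaarMeasure]
    (a : A) (g : C_c(G, ℂ)) : crossedElement S μ a g ∈ crossedProductSubalgebra S μ :=
  NonUnitalStarSubalgebra.le_topologicalClosure _
    (NonUnitalStarAlgebra.subset_adjoin ℂ _ ⟨(a, g), rfl⟩)

theorem isClosed_crossedProductSubalgebra (S : CStarSystem G A) (μ : Measure G)
    [μ.IsAddHaarMeasure] : IsClosed (crossedProductSubalgebra S μ : Set (UniversalAlgebra S)) :=
  NonUnitalStarSubalgebra.isClosed_topologicalClosure _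

end crossedElement

/-- The indicator function of a lattice point. -/
def latticeDelta (q : Fin d → ℤ) : C_c((Fin d → ℤ), ℂ) :=
  ⟨⟨Pi.single q 1, continuous_of_discreteTopology⟩, 
    HasCompactSupport.of_support_subset_isCompact (K := {q}) isCompact_singleton
      Pi.support_single_subset⟩

theorem latticeDelta_apply (q p : Fin d → ℤ) :
    latticeDelta q p = (Pi.single q 1 : (Fin d → ℤ) → ℂ) p := rfl

/-- Multiplication of a compactly supported function by the phase attached to a lattice point. -/
def latticePhaseMul (q : Fin d → ℤ) (g : C_c(EuclideanSpace ℝ (Fin n), ℂ)) :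
    C_c(EuclideanSpace ℝ (Fin n), ℂ) :=
  ⟨⟨fun s => latticePhase Λ s q * g s, (continuous_latticePhase Λ q).mul g.continuous⟩,
    g.hasCompactSupport.mul_left⟩

theorem CovariantRep.integrated_count (ρ : CovariantRep (affineSystem Λ))
    (h : C_c((Fin d → ℤ), ℂ)) (s : Finset (Fin d → ℤ)) (hs : ∀ q ∉ s, h q = 0) (ξ : ρ.H) :
    ρ.integrated Measure.count h ξ = ∑ q ∈ s, h q • ρ.U q ξ := by
  change ∫ q, h q • ρ.U q ξ ∂Measure.count = _
  rw [integral_countable (ρ.integrable_smul_U _ h ξ), tsum_eq_sum (s := s)]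
  · simp
  · intro q hq
    simp [hs q hq]

theorem integrable_coe (g : C_c(EuclideanSpace ℝ (Fin n), ℂ)) : Integrable ⇑g :=
  g.continuous.integrable_of_hasCompactSupport g.hasCompactSupport

theorem CovariantRep.toDual_integrated (ρ : CovariantRep (affineSystem Λ))
    (g : C_c(EuclideanSpace ℝ (Fin n), ℂ)) :
    ρ.toDual.integrated volume g = ρ.π (fourierInvC0 g) :=
  ρ.charRep.integral_eq_of_nondegenerate ρ.π ρ.nondegenerate ρ.charRep_apply (integrable_coe g)

theorem CovariantRep.ofDual_π_fourierInvC0 (ρ : CovariantRep (dualSystem Λ))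
    (g : C_c(EuclideanSpace ℝ (Fin n), ℂ)) :
    ρ.ofDual.π (fourierInvC0 g) = ρ.integrated volume g :=
  ρ.spectralRep_fourierInvC0 (integrable_coe g)

/-- By linearity and density f may be a monomial e_q. Then U_q π(𝓕⁻ g) = π(α_q(𝓕⁻ g)) U_q, which is
a single generator with the lattice delta at q. -/
theorem pullToDual_crossedElement_mem (f : C(UnitAddTorus (Fin d), ℂ))
    (g : C_c(EuclideanSpace ℝ (Fin n), ℂ)) :
    pullToDual Λ (crossedElement (dualSystem Λ) volume f g) ∈
      crossedProductSubalgebra (affineSystem Λ) Measure.count := by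
  let K := crossedProductSubalgebra (affineSystem Λ) Measure.count
  refine mem_of_mFourier_mem K.toSubmodule (isClosed_crossedProductSubalgebra _ _)
    ((pullToDual Λ).toCLM.comp (crossedElementCLM (dualSystem Λ) volume g)) (fun q => ?_) f
  have h : pullToDual Λ (crossedElement (dualSystem Λ) volume (UnitAddTorus.mFourier q) g) =
      crossedElement (affineSystem Λ) Measure.count
        ((affineSystem Λ).act q (fourierInvC0 g)) (latticeDelta q) := by
    ext ρ ξ
    change ρ.torusRep (UnitAddTorus.mFourier q) (ρ.toDual.integrated volume g ξ) =
      ρ.π ((affineSystem Λ).act q (fourierInvC0 g))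
        (ρ.integrated Measure.count (latticeDelta q) ξ)
    rw [ρ.torusRep_mFourier, ρ.toDual_integrated, ρ.covariant, ρ.integrated_count _ _ {q}]
    · simp [latticeDelta_apply]
    · intro p hp
      rw [latticeDelta_apply, Pi.single_eq_of_ne (by simpa using hp)]
  exact h ▸ crossedElement_mem (affineSystem Λ) Measure.count _ _

/-- By density a = 𝓕⁻ g, and h has finite support because ℤᵈ is discrete. Moving V(g) to the right
past each σ(e_q) gives a finite sum of generators, with g multiplied by a phase. -/
theorem pullOfDual_crossedElement_mem (a : C₀(EuclideanSpace ℝ (Fin n), ℂ))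
    (h : C_c((Fin d → ℤ), ℂ)) :
    pullOfDual Λ (crossedElement (affineSystem Λ) Measure.count a h) ∈
      crossedProductSubalgebra (dualSystem Λ) volume := by
  let L := (pullOfDual Λ).toCLM.comp (crossedElementCLM (affineSystem Λ) Measure.count h)
  refine dense_range_fourierInvC0.induction_on (p := fun a => L a ∈
    crossedProductSubalgebra (dualSystem Λ) volume) a
    ((isClosed_crossedProductSubalgebra _ _).preimage L.continuous) fun g => ?_
  have hfin : (Function.support h).Finite :=
    (h.hasCompactSupport.isCompact.finite_of_discrete).subset (subset_tsupport h)
  have hsum : L (fourierInvC0 g) = ∑ q ∈ hfin.toFinset, crossedElement (dualSystem Λ) volume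
      (h q • UnitAddTorus.mFourier q) (latticePhaseMul Λ q g) := by
    ext ρ ξ
    rw [lp.coeFn_sum, Finset.sum_apply, _root_.sum_apply]
    change ρ.ofDual.π (fourierInvC0 g) (ρ.ofDual.integrated Measure.count h ξ) = _
    rw [ρ.ofDual_π_fourierInvC0, ρ.ofDual.integrated_count _ h hfin.toFinset (by simp), map_sum]
    refine Finset.sum_congr rfl fun q _ => ?_
    rw [map_smul, crossedElement_apply, map_smul]
    exact congrArg (h q • ·) (ρ.π_mFourier_integral q (integrable_coe g)
      (integrable_coe (latticePhaseMul Λ q g)) ξ)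
  rw [hsum]
  exact sum_mem fun q _ => crossedElement_mem _ _ _ _

/-- The round trip recovers V(g) through 𝓕⁻ g, and recovers π because it does so on monomials. -/
theorem pullOfDual_pullToDual_crossedElement (f : C(UnitAddTorus (Fin d), ℂ))
    (g : C_c(EuclideanSpace ℝ (Fin n), ℂ)) :
    pullOfDual Λ (pullToDual Λ (crossedElement (dualSystem Λ) volume f g)) =
      crossedElement (dualSystem Λ) volume f g := by
  ext ρ : 2
  change ρ.ofDual.torusRep f * ρ.ofDual.toDual.integrated volume g =
    ρ.π f * ρ.integrated volume g
  rw [CovariantRep.toDual_integrated, CovariantRep.ofDual_π_fourierInvC0]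
  congr 1
  let σ : C(UnitAddTorus (Fin d), ℂ) →⋆ₙₐ[ℂ] (ρ.H →L[ℂ] ρ.H) := ρ.ofDual.torusRep
  suffices σ.toCLM = ρ.π.toCLM from DFunLike.congr_fun this f
  refine ext_mFourier fun q => ?_
  ext ξ
  exact ρ.ofDual.torusRep_mFourier q ξ

theorem pullToDual_pullOfDual_crossedElement (a : C₀(EuclideanSpace ℝ (Fin n), ℂ))
    (h : C_c((Fin d → ℤ), ℂ)) :
    pullToDual Λ (pullOfDual Λ (crossedElement (affineSystem Λ) Measure.count a h)) =
      crossedElement (affineSystem Λ) Measure.count a h := by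
  ext ρ : 2
  change ρ.toDual.spectralRep a * ρ.toDual.ofDual.integrated Measure.count h =
    ρ.π a * ρ.integrated Measure.count h
  congr 1
  · refine dense_range_fourierInvC0.induction_on (p := fun a => ρ.toDual.spectralRep a = ρ.π a) a
      (isClosed_eq ρ.toDual.spectralRep.continuous_of_cstar ρ.π.continuous_of_cstar) fun g => ?_
    exact (ρ.toDual.ofDual_π_fourierInvC0 Λ g).trans (ρ.toDual_integrated Λ g)
  · ext ξ
    change ∫ q, h q • ρ.torusRep (UnitAddTorus.mFourier q) ξ ∂Measure.count =
      ∫ q, h q • ρ.U q ξ ∂Measure.count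
    simp_rw [ρ.torusRep_mFourier]

end

theorem mainTheorem10 (d n : ℕ) (Λ : Matrix (Fin d) (Fin n) ℝ) :
    Nonempty
      (CrossedProduct (affineSystem Λ) (MeasureTheory.Measure.count : MeasureTheory.Measure (Fin d → ℤ))
        ≃⋆ₐ[ℂ]
      CrossedProduct (dualSystem Λ)
        (MeasureTheory.volume : MeasureTheory.Measure (EuclideanSpace ℝ (Fin n)))) := by
  -- Both crossed products unfold to closures of generated *-algebras, so only the generators need
  -- checking.
  refine NonUnitalStarAlgebra.nonempty_equiv_topologicalClosure_adjoin _ _ (pullOfDual Λ)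
    (pullToDual Λ) ?_ ?_ ?_ ?_
  · rintro _ ⟨⟨a, h⟩, rfl⟩
    exact pullOfDual_crossedElement_mem Λ a h
  · rintro _ ⟨⟨f, g⟩, rfl⟩
    exact pullToDual_crossedElement_mem Λ f g
  · rintro _ ⟨⟨a, h⟩, rfl⟩
    exact pullToDual_pullOfDual_crossedElement Λ a h
  · rintro _ ⟨⟨f, g⟩, rfl⟩
    exact pullOfDual_pullToDual_crossedElement Λ f g
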